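/- Let $E$ be a finite set of $n$ items and let $O$ be a set of states. A realization is a map $\phi:E\to O$; let $\Phi$ be a random realization with a known discrete law $p$. Let $f:2^E\times O^E\to\mathbb R_{\ge 0}$ be a utility function such that $\mathbb E[f(S,\Phi)]<\infty$ for every $S\subseteq E$. A partial realization $\psi$ assigns states to the items of a set $\mathrm{dom}(\psi)\subseteq E$; write $\Phi\sim\psi$ if $\Phi$ agrees with $\psi$ on $\mathrm{dom}(\psi)$, and $\psi\subseteq\psi'$ if $\psi'$ extends $\psi$. For $e\in E$ and $\Pr[\Phi\sim\psi]>0$ put $$\Delta(e\mid\psi)=\mathbb E\big[f(\mathrm{dom}(\psi)\cup\{e\},\Phi)-f(\mathrm{dom}(\psi),\Phi)\,\big|\,\Phi\sim\psi\big].$$ The function $f$ is adaptive submodular with respect to $p$ if $\Delta(e\mid\psi)\ge\Delta(e\mid\psi')$ whenever $\psi\subseteq\psi'$, $\Pr[\Phi\sim\psi']>0$ and $e\in E\setminus\mathrm{dom}(\psi')$. A (randomized) adaptive policy $\pi$ is a map from partial realizations to probability distributions on the possible next steps, namely to select an item that has not been selected yet, whose state is then observed, or to stop. Let $E(\pi,\phi)$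 be the random set of items that $\pi$ selects under the realization $\phi$ and let $f_{avg}(\pi)=\mathbb E[f(E(\pi,\Phi),\Phi)]$, the internal randomness of $\pi$ being independent of $\Phi$; the same notation is used for randomized algorithms that select items and observe their states. A policy is feasible if $|E(\pi,\phi)|\le k$ always. A value oracle query asks for $\Delta(e\mid\psi)$ for one item $e$ and one partial realization $\psi$. Let $1\le k\le n$ and $0<\epsilon<1/2$, and put $$q=8k^{-1}\epsilon^{-2}\ln\frac1{2\epsilon},\qquad m=\min\{\lceil qn\rceil,n\},\qquad s=\frac{km}{n}.$$ The Linear-Time Adaptive Policy $\pi^{lt}$ starts with nothing selected and performs $k$ rounds. In round $r$, with $\psi^{r-1}$ the partial realization observed so far, it draws, with fresh independent randomness, a uniformly random subset $S_r\subseteq E$ of size $m$ and a number $d_r$ uniformly distributed on $(0,s]$; it queries $\Delta(e\mid\psi^{r-1})$ for all $e\in S_r$, and lets $e'_r$ be the item of $S_r$ with the $\lceil d_r\rceil$-th largest value $\Delta(e\mid\psi^{r-1})$ (ties are broken by any fixed rule). If $\Delta(e'_r\mid\psi^{r-1})\ge 0$, it selects $e'_r$ and observes its state; otherwise it selects nothing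 in this round. **Theorem.** There is an absolute constant $C$ such that for all data as above, if $f$ is adaptive submodular with respect to $p$, then $\pi^{lt}$ never selects more than $k$ items, $$f_{avg}(\pi^{lt})\ \ge\ \Big(\frac1e-\epsilon\Big)\,f_{avg}(\pi)\qquad\text{for every feasible policy }\pi$$ (so in particular for an optimal one), and every run of $\pi^{lt}$ uses at most $C\,n\,\epsilon^{-2}\ln\epsilon^{-1}$ value oracle queries. -/

import Mathlib

noncomputable section

open scoped Classical

namespace AdaptiveSubmod

universe u v

/-! ### Realizations, partial realizations, marginal utilities -/

/-- A partial realization assigns a state to the items that have been observed, and `none`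
to the others. A (full) realization is a function `φ : E → O`. -/
abbrev PartialRealization (E : Type u) (O : Type v) := E → Option O

variable {E : Type u} {O : Type v} [Fintype E]

/-- The set of items involved in `ψ`. -/
def dom (ψ : PartialRealization E O) : Finset E :=
  Finset.univ.filter fun e => (ψ e).isSome

/-- `φ ∼ ψ`: the realization `φ` agrees with `ψ` on the domain of `ψ`. -/
def Consistent (φ : E → O) (ψ : PartialRealization E O) : Prop :=
  ∀ e o, ψ e = some o → φ e = o

/-- `ψ ⊆ ψ'`: the partial realization `ψ'` extends `ψ`. -/
def Subrealization (ψ ψ' : PartialRealization E O) : Prop :=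
  ∀ e o, ψ e = some o → ψ' e = some o

/-- The partial realization obtained from `ψ` after observing that `e` is in state `o`. -/
def observe (ψ : PartialRealization E O) (e : E) (o : O) : PartialRealization E O :=
  Function.update ψ e (some o)

/-- `Pr[Φ ∼ ψ]` for a random realization `Φ` with law `p`. -/
def prob (p : PMF (E → O)) (ψ : PartialRealization E O) : ℝ :=
  ∑' φ, if Consistent φ ψ then (p φ).toReal else 0

/-- `Δ(S ∣ ψ) = 𝔼[f(dom ψ ∪ S, Φ) - f(dom ψ, Φ) ∣ Φ ∼ ψ]`. It is meaningful when
`Pr[Φ ∼ ψ] > 0`. -/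
def marginal (p : PMF (E → O)) (f : Finset E → (E → O) → ℝ) (S : Finset E)
    (ψ : PartialRealization E O) : ℝ :=
  (∑' φ, if Consistent φ ψ then (p φ).toReal * (f (dom ψ ∪ S) φ - f (dom ψ) φ) else 0)
    / prob p ψ

/-- Adaptive submodularity: the conditional expected marginal utility of an item that is not yet
selected does not increase when more observations are made. Partial realizations of probability
zero are excluded, since conditioning on them has no meaning. -/
def AdaptiveSubmodular (p : PMF (E → O)) (f : Finset E → (E → O) → ℝ) : Prop :=
  ∀ ψ ψ' : PartialRealization E O, Subrealization ψ ψ' → 0 < prob p ψ' →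
    ∀ e, e ∉ dom ψ' → marginal p f {e} ψ' ≤ marginal p f {e} ψ

/-! ### Expected utility and adaptive policies -/

/-- Expected utility of a randomized selection that, under the realization `φ`, selects a random
set of items with law `sel φ`; the internal randomness is independent of `Φ`. -/
def expectedUtility (p : PMF (E → O)) (f : Finset E → (E → O) → ℝ)
    (sel : (E → O) → PMF (Finset E)) : ℝ :=
  ∑' φ, (p φ).toReal * ∑ S : Finset E, (sel φ S).toReal * f S φ

/-- A (randomized) adaptive policy: given the current partial realization, it returns a
distribution on the next step, which is to select a new item (`some e`) or to end (`none`). -/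
structure Policy (E : Type u) (O : Type v) [Fintype E] where
  next : PartialRealization E O → PMF (Option E)
  fresh : ∀ ψ e, some e ∈ (next ψ).support → e ∉ dom ψ

/-- Law of the final partial realization when the policy is run under the realization `φ` from
`ψ` on, for at most `t` more selections. -/
def Policy.runFrom (π : Policy E O) (φ : E → O) :
    ℕ → PartialRealization E O → PMF (PartialRealization E O)
  | 0, ψ => PMF.pure ψ
  | t + 1, ψ => (π.next ψ).bind fun a =>
      match a with
      | none => PMF.pure ψ
      | some e => π.runFrom φ t (observe ψ e (φ e))

/-- Law of `E(π, φ)`, the set of items selected by `π` under the realization `φ`. As each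
selected item is new, no run makes more than `|E|` selections. -/
def Policy.selected (π : Policy E O) (φ : E → O) : PMF (Finset E) :=
  (π.runFrom φ (Fintype.card E) fun _ => none).map dom

/-- The policy never selects more than `k` items. -/
def Policy.Feasible (π : Policy E O) (k : ℕ) : Prop :=
  ∀ φ, ∀ A ∈ (π.selected φ).support, A.card ≤ k

/-! ### Randomized adaptive algorithms with access to a value oracle -/

/-- An algorithm interacts with its environment in four ways: it draws random data, it asks the
value oracle for `Δ(e ∣ ψ)`, it selects an item and thereby observes its state, and it halts. -/
inductive Algorithm (E : Type u) (O : Type v) where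
  | halt : Algorithm E O
  | drawSet (μ : PMF (Finset E)) (next : Finset E → Algorithm E O) : Algorithm E O
  | drawNat (μ : PMF ℕ) (next : ℕ → Algorithm E O) : Algorithm E O
  | query (e : E) (ψ : PartialRealization E O) (next : ℝ → Algorithm E O) : Algorithm E O
  | select (e : E) (next : O → Algorithm E O) : Algorithm E O

/-- Joint law of the set of selected items and of the number of oracle queries, when the
algorithm is run with the given value oracle under the realization `φ`. -/
def Algorithm.run (oracle : E → PartialRealization E O → ℝ) (φ : E → O) :
    Algorithm E O → PMF (Finset E × ℕ)
  | .halt => PMF.pure (∅, 0)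
  | .drawSet μ next => μ.bind fun S => (next S).run oracle φ
  | .drawNat μ next => μ.bind fun i => (next i).run oracle φ
  | .query e ψ next => ((next (oracle e ψ)).run oracle φ).map fun x => (x.1, x.2 + 1)
  | .select e next => ((next (φ e)).run oracle φ).map fun x => (insert e x.1, x.2)

/-- Ask for `Δ(e ∣ ψ)` for all `e` in a list, record the answers in `val`, and continue. -/
def queryAll (ψ : PartialRealization E O) :
    List E → (E → ℝ) → ((E → ℝ) → Algorithm E O) → Algorithm E O
  | [], val, next => next val
  | e :: l, val, next => .query e ψ fun a => queryAll ψ l (Function.update val e a) next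

/-! ### The linear-time adaptive policy -/

/-- A way to list the items of a set from the largest to the smallest value (that is, a sorting
procedure with some rule for breaking ties). -/
structure Ranking (E : Type u) where
  list : Finset E → (E → ℝ) → List E
  nodup : ∀ S val, (list S val).Nodup
  mem_list : ∀ S val e, e ∈ list S val ↔ e ∈ S
  sorted : ∀ S val, (list S val).Pairwise fun a b => val b ≤ val a

instance : Nonempty (Ranking E) :=
  ⟨{ list := fun S val => S.toList.mergeSort fun a b => decide (val b ≤ val a)
     nodup := fun S val => (List.mergeSort_perm _ _).nodup_iff.2 S.nodup_toList
     mem_list := fun S val e => by rw [(List.mergeSort_perm _ _).mem_iff, Finset.mem_toList]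
     sorted := fun S val => by
      have h := List.pairwise_mergeSort (le := fun a b : E => decide (val b ≤ val a))
        (fun a b c h1 h2 => by simp only [decide_eq_true_eq] at *; exact h2.trans h1)
        (fun a b => by simpa using le_total (val b) (val a)) S.toList
      simpa using h }⟩

/-- Uniform law on the subsets of `E` with exactly `m` elements. -/
def uniformSubset (E : Type u) [Fintype E] (m : ℕ) (hm : m ≤ Fintype.card E) : PMF (Finset E) :=
  PMF.uniformOfFinset (Finset.powersetCard m Finset.univ) (Finset.powersetCard_nonempty.2 hm)

/-- The uniform probability measure on the interval `(0, s]`. -/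
def uniformIoc (s : ℝ) : MeasureTheory.Measure ℝ :=
  ProbabilityTheory.cond MeasureTheory.volume (Set.Ioc 0 s)

theorem isProbabilityMeasure_map_ceil {s : ℝ} (hs : 0 < s) :
    MeasureTheory.IsProbabilityMeasure ((uniformIoc s).map Nat.ceil) := by
  have : MeasureTheory.IsProbabilityMeasure (uniformIoc s) :=
    ProbabilityTheory.cond_isProbabilityMeasure_of_finite (by simp [hs]) (by simp)
  exact MeasureTheory.Measure.isProbabilityMeasure_map Nat.measurable_ceil.aemeasurable

/-- Law of `⌈d⌉` for `d` uniform on `(0, s]`. Only `s > 0` matters. -/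
def ceilUniform (s : ℝ) : PMF ℕ :=
  if hs : 0 < s then
    haveI := isProbabilityMeasure_map_ceil hs
    ((uniformIoc s).map Nat.ceil).toPMF
  else PMF.pure 0

/-- `r` rounds of the policy, started at the current partial realization `ψ`: draw a uniformly
random set `S` of `m` items, draw `d` uniformly from `(0, s]`, take the item of `S` with the
`⌈d⌉`-th largest marginal utility, and select it if its marginal utility is nonnegative. -/
def linearTimeRounds (ρ : Ranking E) (m : ℕ) (hm : m ≤ Fintype.card E) (s : ℝ) :
    ℕ → PartialRealization E O → Algorithm E O
  | 0, _ => .halt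
  | r + 1, ψ =>
    .drawSet (uniformSubset E m hm) fun S =>
    .drawNat (ceilUniform s) fun i =>
    queryAll ψ S.toList (fun _ => 0) fun val =>
      match (ρ.list S val)[i - 1]? with
      | none => linearTimeRounds ρ m hm s r ψ
      | some e =>
        if 0 ≤ val e then
          .select e fun o => linearTimeRounds ρ m hm s r (observe ψ e o)
        else linearTimeRounds ρ m hm s r ψ

/-- `q = 8 k⁻¹ ε⁻² ln (2ε)⁻¹`. -/
def qParam (k : ℕ) (ε : ℝ) : ℝ := 8 * (k : ℝ)⁻¹ * (ε ^ 2)⁻¹ * Real.log (2 * ε)⁻¹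

/-- The size `min {⌈q n⌉, n}` of the random sets. -/
def sampleSize (n k : ℕ) (ε : ℝ) : ℕ := min ⌈qParam k ε * n⌉₊ n

/-- `s = k min {⌈q n⌉, n} / n`. -/
def sParam (n k : ℕ) (ε : ℝ) : ℝ := k * sampleSize n k ε / n

/-- The linear-time adaptive policy, with ties broken according to `ρ`. -/
def linearTimePolicy (O : Type v) (ρ : Ranking E) (k : ℕ) (ε : ℝ) : Algorithm E O :=
  linearTimeRounds ρ (sampleSize (Fintype.card E) k ε) (min_le_right _ _)
    (sParam (Fintype.card E) k ε) k fun _ => none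

/-- Joint law of the selected set and of the number of value oracle queries of the linear-time
adaptive policy, under the realization `φ`, for the value oracle `(e, ψ) ↦ Δ(e ∣ ψ)`. -/
def linearTimeRun (p : PMF (E → O)) (f : Finset E → (E → O) → ℝ) (ρ : Ranking E) (k : ℕ)
    (ε : ℝ) (φ : E → O) : PMF (Finset E × ℕ) :=
  (linearTimePolicy O ρ k ε).run (fun e ψ => marginal p f {e} ψ) φ

end AdaptiveSubmod

end

/-!
The policy is a random greedy algorithm, and its guarantee rests on two estimates for one round,
in expectation given the observations made so far.

*Little is lost.* Every item is selected with probability at most `1 / k`, because it lies in the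
random set with probability `m / n` and then occupies a rank of probability at most
`1 / s = n / (k m)` (`choice_apply_le`). Let `D` be a set that consists of the selected items and
of those selected by an independent run of a competing policy `π`. By adaptive submodularity, the
items with a negative marginal utility cannot together lower the expected utility by more than its
current amount, since `f ≥ 0` (`neg_mean_le_mean_sum_min`). Hence a round preserves at
least the fraction `1 - 1 / k` of the expected utility of `D` (`mean_ev_policy_addOpt_ge`).

*Much is gained.* By adaptive submodularity, running a feasible `π` on top of the current selection
gains at most the sum of the nonnegative parts of the current marginal utilities of the at most
`k` items that `π` selects (`Policy.mean_gain_le`). For every set `M` of `k` items, a round gains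
in expectation at least `(1 - ε) / k` times such a sum over `M` (`sum_choice_mul_ge`). Indeed, if
`X` is the number of items of `M` in the random set, the round collects on average at least
`min (1, s / X) / s` times the sum over these items; by symmetry all items of `M` benefit equally,
and `𝔼[min (X, s)] ≥ (1 - ε) s`, because `X` is hypergeometric with mean `s` and variance at most
`s` (`ev_min_card_inter_ge`).

Iterating over `k` rounds gives the factor `(1 - ε) (1 - 1 / k) ^ (k - 1) ≥ 1 / e - ε`
(`mean_greedyLaw_ge`). For `ε ≥ 1 / e` the factor is not positive, and the bound is trivial.
Below this threshold `s ≥ 2 / ε²` unless `m = n`, as the estimate of `𝔼[min (X, s)]` requires.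

After the items of a set `A` are selected, the observed partial realization is determined by `A`
and the realization `φ`. The state of a process is therefore encoded by the finite set `A`, and an
event or a probability given the observations is encoded by a weight `c φ` that depends only on the
states of the items of `A`. Conditioning then amounts to the tower property `mean_mul_condMean`,
and expectations over the infinite set of partial realizations become finite sums over `A`.
-/

noncomputable section

open scoped Classical

namespace AdaptiveSubmod

universe u v

variable {E : Type u} {O : Type v}

/-! ### Expectations over the random realization -/

/-- The expectation `𝔼[g(Φ)]` for `Φ` with law `p`. -/
def mean (p : PMF (E → O)) (g : (E → O) → ℝ) : ℝ := ∑' φ, (p φ).toReal * g φ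

/-- `g(Φ)` has a finite expectation. -/
def Integ (p : PMF (E → O)) (g : (E → O) → ℝ) : Prop := Summable fun φ => (p φ).toReal * g φ

section mean

variable {p : PMF (E → O)} {g h : (E → O) → ℝ}

theorem summable_toReal {α : Type*} (μ : PMF α) : Summable fun a => (μ a).toReal :=
  ENNReal.summable_toReal μ.tsum_coe_ne_top

theorem tsum_toReal {α : Type*} (μ : PMF α) : ∑' a, (μ a).toReal = 1 := by
  rw [← ENNReal.tsum_toReal_eq fun a => μ.apply_ne_top a, μ.tsum_coe, ENNReal.toReal_one]

theorem toReal_le_one {α : Type*} (μ : PMF α) (a : α) : (μ a).toReal ≤ 1 := by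
  have := ENNReal.toReal_mono ENNReal.one_ne_top (μ.coe_le_one a)
  simpa using this

theorem Integ.add (hg : Integ p g) (hh : Integ p h) : Integ p fun φ => g φ + h φ := by
  simpa only [Integ, mul_add] using Summable.add hg hh

theorem Integ.sub (hg : Integ p g) (hh : Integ p h) : Integ p fun φ => g φ - h φ := by
  simpa only [Integ, mul_sub] using Summable.sub hg hh

theorem Integ.const_mul (a : ℝ) (hg : Integ p g) : Integ p fun φ => a * g φ := by
  simpa only [Integ, mul_left_comm] using Summable.mul_left a hg

theorem Integ.abs (hg : Integ p g) : Integ p fun φ => |g φ| := by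
  have := Summable.abs hg
  simpa only [Integ, abs_mul, ENNReal.abs_toReal] using this

theorem Integ.sum {ι : Type*} {s : Finset ι} {G : ι → (E → O) → ℝ}
    (hG : ∀ i ∈ s, Integ p (G i)) : Integ p fun φ => ∑ i ∈ s, G i φ := by
  simpa only [Integ, Finset.mul_sum] using summable_sum hG

theorem Integ.of_abs_le (hg : Integ p g) (hh : ∀ φ, |h φ| ≤ |g φ|) : Integ p h := by
  refine Summable.of_norm_bounded hg.abs fun φ => ?_
  rw [Real.norm_eq_abs, abs_mul, ENNReal.abs_toReal]
  exact mul_le_mul_of_nonneg_left (hh φ) ENNReal.toReal_nonneg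

theorem Integ.weight_mul {c : (E → O) → ℝ} (hc : ∀ φ, c φ ∈ Set.Icc (0 : ℝ) 1)
    (hg : Integ p g) : Integ p fun φ => c φ * g φ := by
  refine hg.of_abs_le fun φ => ?_
  rw [abs_mul, abs_of_nonneg (hc φ).1]
  exact mul_le_of_le_one_left (abs_nonneg _) (hc φ).2

theorem mean_add (hg : Integ p g) (hh : Integ p h) :
    mean p (fun φ => g φ + h φ) = mean p g + mean p h := by
  simpa only [mean, mul_add] using Summable.tsum_add hg hh

theorem mean_sub (hg : Integ p g) (hh : Integ p h) :
    mean p (fun φ => g φ - h φ) = mean p g - mean p h := by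
  simpa only [mean, mul_sub] using Summable.tsum_sub hg hh

theorem mean_const_mul (a : ℝ) : mean p (fun φ => a * g φ) = a * mean p g := by
  simp only [mean, mul_left_comm _ a, tsum_mul_left]

theorem mean_sum {ι : Type*} {s : Finset ι} {G : ι → (E → O) → ℝ}
    (hG : ∀ i ∈ s, Integ p (G i)) :
    mean p (fun φ => ∑ i ∈ s, G i φ) = ∑ i ∈ s, mean p (G i) := by
  simpa only [mean, Finset.mul_sum] using Summable.tsum_finsetSum hG

/-- Only realizations of positive probability matter for comparing expectations. -/
theorem mean_mono (hg : Integ p g) (hh : Integ p h) (H : ∀ φ, 0 < (p φ).toReal → g φ ≤ h φ) :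
    mean p g ≤ mean p h := by
  refine Summable.tsum_le_tsum (fun φ => ?_) hg hh
  rcases eq_or_lt_of_le (ENNReal.toReal_nonneg (a := p φ)) with h0 | h0
  · simp [← h0]
  · exact mul_le_mul_of_nonneg_left (H φ h0) h0.le

theorem mean_nonneg (hg : ∀ φ, 0 ≤ g φ) : 0 ≤ mean p g :=
  tsum_nonneg fun φ => mul_nonneg ENNReal.toReal_nonneg (hg φ)

end mean

/-! ### Observed realizations and conditioning -/

/-- The partial realization observed under `φ` once the items of `A` are selected. -/
def restr (A : Finset E) (φ : E → O) : PartialRealization E O :=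
  fun e => if e ∈ A then some (φ e) else none

theorem restr_empty (φ : E → O) : restr (∅ : Finset E) φ = fun _ => none := by
  ext1 e; simp [restr]

theorem observe_restr (A : Finset E) (φ : E → O) (e : E) :
    observe (restr A φ) e (φ e) = restr (insert e A) φ := by
  ext1 x
  by_cases h : x = e
  · subst h; simp [observe, restr]
  · simp [observe, restr, h]

theorem restr_eq_restr_iff (A : Finset E) (φ φ' : E → O) :
    restr A φ = restr A φ' ↔ ∀ e ∈ A, φ e = φ' e := by
  constructor
  · intro h e he
    have := congrFun h e
    simpa [restr, he] using this
  · intro h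
    ext1 e
    by_cases he : e ∈ A <;> simp [restr, he, h]

theorem consistent_restr_iff (A : Finset E) (φ φ' : E → O) :
    Consistent φ' (restr A φ) ↔ restr A φ' = restr A φ := by
  rw [restr_eq_restr_iff]
  constructor
  · intro h e he
    exact h e (φ e) (by simp [restr, he])
  · intro h e o ho
    by_cases he : e ∈ A
    · simp only [restr, he, if_true, Option.some.injEq] at ho
      rw [h e he, ho]
    · simp [restr, he] at ho

theorem subrealization_restr {A B : Finset E} (h : A ⊆ B) (φ : E → O) :
    Subrealization (restr A φ) (restr B φ) := by
  intro e o ho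
  by_cases he : e ∈ A
  · simpa [restr, he, h he] using ho
  · simp [restr, he] at ho

theorem dependsOn_comp_restr {β : Type*} (A : Finset E) (c : PartialRealization E O → β) :
    DependsOn (fun φ : E → O => c (restr A φ)) (A : Set E) := fun φ φ' h => by
  show c (restr A φ) = c (restr A φ')
  rw [(restr_eq_restr_iff A φ φ').2 fun e he => h e he]

/-- The conditional expectation `𝔼[g(Φ) ∣ Φ ∼ ψ]`. -/
def condMean (p : PMF (E → O)) (g : (E → O) → ℝ) (ψ : PartialRealization E O) : ℝ :=
  (∑' φ, if Consistent φ ψ then (p φ).toReal * g φ else 0) / prob p ψ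

section conditioning

variable {p : PMF (E → O)} {g : (E → O) → ℝ}

theorem prob_restr_pos {φ : E → O} (h : 0 < (p φ).toReal) (A : Finset E) :
    0 < prob p (restr A φ) := by
  have hs : Summable fun φ' => if Consistent φ' (restr A φ) then (p φ').toReal else 0 := by
    refine Summable.of_nonneg_of_le (fun φ' => ?_) (fun φ' => ?_) (summable_toReal p)
    · split_ifs <;> simp
    · split_ifs <;> simp
  refine hs.tsum_pos (fun φ' => ?_) φ ?_
  · split_ifs <;> simp
  · rwa [if_pos ((consistent_restr_iff A φ φ).2 rfl)]

theorem tsum_consistent_eq (A : Finset E) (φ : E → O) (g : (E → O) → ℝ) :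
    (∑' φ', if Consistent φ' (restr A φ) then g φ' else 0) =
      ∑' x : {φ' // restr A φ' = restr A φ}, g x := by
  refine Eq.trans ?_ (tsum_subtype {φ' | restr A φ' = restr A φ} g).symm
  refine tsum_congr fun φ' => ?_
  simp only [Set.indicator, Set.mem_ofPred_eq, consistent_restr_iff]

/-- Averaging the conditional expectation over one fibre gives the average of `g` over it. -/
theorem tsum_fiber_condMean (g : (E → O) → ℝ) (A : Finset E) (ψ : PartialRealization E O) :
    (∑' x : {φ // restr A φ = ψ}, (p x).toReal * condMean p g (restr A x)) =
      ∑' x : {φ // restr A φ = ψ}, (p x).toReal * g x := by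
  by_cases hψ : ∃ φ, restr A φ = ψ
  · obtain ⟨φ, rfl⟩ := hψ
    have h1 : ∀ x : {φ' // restr A φ' = restr A φ}, (p x).toReal * condMean p g (restr A x) =
        (p x).toReal * condMean p g (restr A φ) := fun x => by rw [x.2]
    simp only [h1, tsum_mul_right]
    have h2 : prob p (restr A φ) = ∑' x : {φ' // restr A φ' = restr A φ}, (p x).toReal :=
      tsum_consistent_eq A φ fun φ => (p φ).toReal
    have hsum : Summable fun x : {φ' // restr A φ' = restr A φ} => (p x).toReal :=
      (summable_toReal p).subtype {φ' | restr A φ' = restr A φ}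
    rw [condMean, tsum_consistent_eq A φ fun φ => (p φ).toReal * g φ, h2]
    by_cases h0 : ∑' x : {φ' // restr A φ' = restr A φ}, (p x).toReal = 0
    · rw [h0, zero_mul, eq_comm]
      have := (hasSum_zero_iff_of_nonneg fun _ => ENNReal.toReal_nonneg).1 (h0 ▸ hsum.hasSum)
      have h3 : ∀ x : {φ' // restr A φ' = restr A φ}, (p x).toReal * g x = 0 := fun x => by
        rw [show (p x).toReal = 0 from congrFun this x, zero_mul]
      simp only [h3, tsum_zero]
    · rw [mul_div_cancel₀ _ h0]
  · have : IsEmpty {φ // restr A φ = ψ} := ⟨fun x => hψ ⟨x.1, x.2⟩⟩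
    simp

theorem abs_condMean_le (hg : Integ p g) (ψ : PartialRealization E O) :
    |condMean p g ψ| ≤ condMean p (fun φ => |g φ|) ψ := by
  have hp : 0 ≤ prob p ψ := tsum_nonneg fun φ => by split_ifs <;> simp
  rw [condMean, condMean, abs_div, abs_of_nonneg hp]
  refine div_le_div_of_nonneg_right ?_ hp
  have hs : Summable fun φ => ‖if Consistent φ ψ then (p φ).toReal * g φ else 0‖ := by
    refine Summable.of_nonneg_of_le (fun _ => norm_nonneg _) (fun φ => ?_) hg.abs
    split_ifs
    · simp
    · simp [mul_nonneg]
  refine (norm_tsum_le_tsum_norm hs).trans (le_of_eq (tsum_congr fun φ => ?_))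
  split_ifs <;> simp

theorem Integ.condMean (hg : Integ p g) (A : Finset E) :
    Integ p fun φ => condMean p g (restr A φ) := by
  have key : Integ p fun φ => AdaptiveSubmod.condMean p (fun φ => |g φ|) (restr A φ) := by
    have h0 : ∀ ψ, 0 ≤ AdaptiveSubmod.condMean p (fun φ => |g φ|) ψ := fun ψ =>
      (abs_nonneg _).trans (abs_condMean_le hg ψ)
    rw [Integ, ← (Equiv.sigmaFiberEquiv (restr (O := O) A)).summable_iff]
    refine (summable_sigma_of_nonneg fun x => mul_nonneg ENNReal.toReal_nonneg (h0 _)).2 ?_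
    refine ⟨fun ψ => ?_, ?_⟩
    · have h1 : Summable fun x : {φ' // restr A φ' = ψ} =>
          (p x).toReal * AdaptiveSubmod.condMean p (fun φ => |g φ|) ψ :=
        ((summable_toReal p).subtype {φ' | restr A φ' = ψ}).mul_right _
      refine h1.congr fun x => ?_
      simp [Equiv.sigmaFiberEquiv, x.2]
    · have h2 := (Equiv.sigmaFiberEquiv (restr (O := O) A)).summable_iff.2 hg.abs
      have h3 := ((summable_sigma_of_nonneg fun x =>
        mul_nonneg ENNReal.toReal_nonneg (abs_nonneg _)).1 h2).2
      refine h3.congr fun ψ => ?_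
      exact (tsum_fiber_condMean (fun φ => |g φ|) A ψ).symm
  refine key.of_abs_le fun φ => (abs_condMean_le hg _).trans (le_abs_self _)

theorem mean_condMean (hg : Integ p g) (A : Finset E) :
    mean p (fun φ => condMean p g (restr A φ)) = mean p g := by
  have h1 := HasSum.tsum_fiberwise (hg.condMean A).hasSum (restr A)
  have h2 := HasSum.tsum_fiberwise (Summable.hasSum hg) (restr A)
  exact h1.unique (h2.congr_fun (tsum_fiber_condMean g A))

/-- The tower property: a weight that depends only on the observed states may be averaged
against `g` or against the conditional expectation of `g` given these states. -/
theorem mean_mul_condMean (hg : Integ p g) {A : Finset E} {c : (E → O) → ℝ}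
    (hc : ∀ φ, c φ ∈ Set.Icc (0 : ℝ) 1) (hcA : DependsOn c (A : Set E)) :
    mean p (fun φ => c φ * condMean p g (restr A φ)) = mean p fun φ => c φ * g φ := by
  rw [← mean_condMean (hg.weight_mul hc) A]
  congr 1
  ext1 φ
  rw [condMean, condMean, ← mul_div_assoc, ← tsum_mul_left]
  congr 1
  refine tsum_congr fun φ' => ?_
  split_ifs with h
  · rw [consistent_restr_iff, restr_eq_restr_iff] at h
    rw [hcA (x := φ) (y := φ') fun e he => (h e he).symm]
    ring
  · simp

end conditioning

variable [Fintype E]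

theorem dom_restr (A : Finset E) (φ : E → O) : dom (restr A φ) = A := by
  ext e
  by_cases h : e ∈ A <;> simp [dom, restr, h]

theorem marginal_eq_condMean (p : PMF (E → O)) (f : Finset E → (E → O) → ℝ) (S A : Finset E)
    (φ : E → O) :
    marginal p f S (restr A φ) = condMean p (fun φ' => f (A ∪ S) φ' - f A φ') (restr A φ) := by
  simp only [marginal, condMean, dom_restr]

/-! ### Expectations over finite probability spaces -/

/-- The expectation of `g` under a law `μ` on a finite type. -/
def ev {α : Type*} [Fintype α] (μ : PMF α) (g : α → ℝ) : ℝ := ∑ a, (μ a).toReal * g a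

section ev

variable {α β : Type*} [Fintype α] [Fintype β]

theorem sum_toReal (μ : PMF α) : ∑ a, (μ a).toReal = 1 := by
  rw [← tsum_toReal μ, tsum_fintype]

theorem ev_const (μ : PMF α) (b : ℝ) : ev μ (fun _ => b) = b := by
  rw [ev, ← Finset.sum_mul, sum_toReal, one_mul]

theorem ev_sub (μ : PMF α) (g h : α → ℝ) : ev μ (fun a => g a - h a) = ev μ g - ev μ h := by
  simp only [ev, mul_sub, Finset.sum_sub_distrib]

theorem ev_const_mul (μ : PMF α) (b : ℝ) (g : α → ℝ) : ev μ (fun a => b * g a) = b * ev μ g := by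
  simp only [ev, mul_left_comm _ b, Finset.mul_sum]

theorem ev_mono {μ : PMF α} {g h : α → ℝ} (H : ∀ a ∈ μ.support, g a ≤ h a) :
    ev μ g ≤ ev μ h := by
  refine Finset.sum_le_sum fun a _ => ?_
  by_cases ha : a ∈ μ.support
  · exact mul_le_mul_of_nonneg_left (H a ha) ENNReal.toReal_nonneg
  · rw [(PMF.apply_eq_zero_iff μ a).2 ha]; simp

theorem ev_nonneg {μ : PMF α} {g : α → ℝ} (H : ∀ a, 0 ≤ g a) : 0 ≤ ev μ g :=
  Finset.sum_nonneg fun a _ => mul_nonneg ENNReal.toReal_nonneg (H a)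

theorem ev_pure (a : α) (g : α → ℝ) : ev (PMF.pure a) g = g a := by
  rw [ev, Finset.sum_eq_single a]
  · simp
  · intro b _ hb; simp [hb]
  · simp

theorem ev_bind (μ : PMF α) (κ : α → PMF β) (g : β → ℝ) :
    ev (μ.bind κ) g = ev μ fun a => ev (κ a) g := by
  have h : ∀ b, ((μ.bind κ) b).toReal = ∑ a, (μ a).toReal * (κ a b).toReal := fun b => by
    rw [PMF.bind_apply, tsum_fintype, ENNReal.toReal_sum fun a _ =>
      ENNReal.mul_ne_top (μ.apply_ne_top a) ((κ a).apply_ne_top b)]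
    simp only [ENNReal.toReal_mul]
  simp only [ev, h, Finset.sum_mul, Finset.mul_sum, mul_assoc]
  exact Finset.sum_comm

theorem ev_option {α : Type*} [Fintype α] (μ : PMF (Option α)) (g : Option α → ℝ) :
    ev μ g = g none + ∑ e, (μ (some e)).toReal * (g (some e) - g none) := by
  have h := sum_toReal μ
  rw [Fintype.sum_option] at h
  rw [ev, Fintype.sum_option]
  simp only [mul_sub, Finset.sum_sub_distrib, ← Finset.sum_mul]
  rw [show (μ none).toReal = 1 - ∑ e, (μ (some e)).toReal by linarith]
  ring

theorem toReal_mem_Icc {α : Type*} (μ : PMF α) (a : α) : (μ a).toReal ∈ Set.Icc (0 : ℝ) 1 :=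
  ⟨ENNReal.toReal_nonneg, toReal_le_one μ a⟩

omit [Fintype E] in
theorem Integ.ev {p : PMF (E → O)} {κ : (E → O) → PMF α} {G : α → (E → O) → ℝ}
    (hG : ∀ a, Integ p (G a)) : Integ p fun φ => ev (κ φ) fun a => G a φ :=
  Integ.sum fun a _ => (hG a).weight_mul fun _ => toReal_mem_Icc _ _

end ev

/-! ### Weights depending on observed states -/

/-- A weight with values in `[0, 1]` that is a function of the states of the items of `A`. -/
structure Weight (c : (E → O) → ℝ) (A : Finset E) : Prop where
  mem_Icc : ∀ φ, c φ ∈ Set.Icc (0 : ℝ) 1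
  dependsOn : DependsOn c (A : Set E)

omit [Fintype E] in
theorem Weight.mono {c : (E → O) → ℝ} {A B : Finset E} (hc : Weight c A) (h : A ⊆ B) :
    Weight c B :=
  ⟨hc.mem_Icc, hc.dependsOn.mono (by exact_mod_cast h)⟩

omit [Fintype E] in
theorem Weight.mul {c d : (E → O) → ℝ} {A : Finset E} (hc : Weight c A) (hd : Weight d A) :
    Weight (fun φ => c φ * d φ) A :=
  ⟨fun φ => unitInterval.mul_mem (hc.mem_Icc φ) (hd.mem_Icc φ), fun φ φ' h => by
    show c φ * d φ = c φ' * d φ'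
    rw [hc.dependsOn h, hd.dependsOn h]⟩

omit [Fintype E] in
theorem weight_one : Weight (fun _ : E → O => (1 : ℝ)) ∅ :=
  ⟨fun _ => by simp, fun _ _ _ => rfl⟩

omit [Fintype E] in
theorem weight_restr {α : Type*} (κ : PartialRealization E O → PMF α) (a : α) (A : Finset E) :
    Weight (fun φ : E → O => (κ (restr A φ) a).toReal) A :=
  ⟨fun _ => toReal_mem_Icc _ _, dependsOn_comp_restr A fun ψ => (κ ψ a).toReal⟩

/-! ### Consequences of adaptive submodularity -/

section submodular

variable {p : PMF (E → O)} {f : Finset E → (E → O) → ℝ}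

theorem marginal_singleton_restr (A : Finset E) (e : E) (φ : E → O) :
    marginal p f {e} (restr A φ) =
      condMean p (fun φ' => f (insert e A) φ' - f A φ') (restr A φ) := by
  rw [marginal_eq_condMean, Finset.union_singleton]

theorem marginal_of_mem {A : Finset E} {e : E} (he : e ∈ A) (φ : E → O) :
    marginal p f {e} (restr A φ) = 0 := by
  rw [marginal_singleton_restr, Finset.insert_eq_of_mem he]
  simp [condMean]

theorem integ_marginal (hf : ∀ S, Integ p (f S)) (A : Finset E) (e : E) :
    Integ p fun φ => marginal p f {e} (restr A φ) := by
  simp only [marginal_singleton_restr]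
  exact ((hf _).sub (hf _)).condMean A

theorem mean_weight_mul_marginal (hf : ∀ S, Integ p (f S)) {A : Finset E} {c : (E → O) → ℝ}
    (hc : Weight c A) (e : E) :
    mean p (fun φ => c φ * marginal p f {e} (restr A φ)) =
      mean p fun φ => c φ * (f (insert e A) φ - f A φ) := by
  simp only [marginal_singleton_restr]
  exact mean_mul_condMean ((hf _).sub (hf _)) hc.mem_Icc hc.dependsOn

theorem marginal_restr_anti (hs : AdaptiveSubmodular p f) {A B : Finset E} (h : A ⊆ B) {e : E}
    (he : e ∉ B) {φ : E → O} (hφ : 0 < (p φ).toReal) :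
    marginal p f {e} (restr B φ) ≤ marginal p f {e} (restr A φ) :=
  hs _ _ (subrealization_restr h φ) (prob_restr_pos hφ B) e (by rwa [dom_restr])

/-- The expected gain of a fixed set of items is at most the sum of the marginal utilities. -/
theorem mean_union_sub_le (hf : ∀ S, Integ p (f S)) (hs : AdaptiveSubmodular p f)
    {D : Finset E} {c : (E → O) → ℝ} (hc : Weight c D) (N : Finset E) :
    mean p (fun φ => c φ * (f (D ∪ N) φ - f D φ)) ≤
      mean p fun φ => c φ * ∑ e ∈ N, marginal p f {e} (restr D φ) := by
  have hI : ∀ N : Finset E, Integ p fun φ => c φ * ∑ e ∈ N, marginal p f {e} (restr D φ) :=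
    fun N => (Integ.sum fun e _ => integ_marginal hf D e).weight_mul hc.mem_Icc
  have hJ : ∀ S T : Finset E, Integ p fun φ => c φ * (f S φ - f T φ) :=
    fun S T => ((hf S).sub (hf T)).weight_mul hc.mem_Icc
  induction N using Finset.induction_on with
  | empty => simp
  | insert e N he ih =>
    simp only [Finset.sum_insert he, mul_add]
    rw [mean_add ((integ_marginal hf D e).weight_mul hc.mem_Icc) (hI N), Finset.union_insert]
    by_cases heD : e ∈ D
    · rw [Finset.insert_eq_of_mem (Finset.mem_union_left _ heD)]
      simp only [marginal_of_mem heD, mul_zero]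
      simpa [mean] using ih
    · have h1 : ∀ φ, c φ * (f (insert e (D ∪ N)) φ - f D φ) =
          c φ * (f (insert e (D ∪ N)) φ - f (D ∪ N) φ) + c φ * (f (D ∪ N) φ - f D φ) :=
        fun φ => by ring
      simp only [h1]
      rw [mean_add (hJ _ _) (hJ _ _),
        ← mean_weight_mul_marginal hf (hc.mono Finset.subset_union_left) e]
      refine add_le_add (mean_mono ((integ_marginal hf _ e).weight_mul hc.mem_Icc)
        ((integ_marginal hf D e).weight_mul hc.mem_Icc) fun φ hφ => ?_) ih
      exact mul_le_mul_of_nonneg_left (marginal_restr_anti hs Finset.subset_union_left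
        (by simp [he, heD]) hφ) (hc.mem_Icc φ).1

omit [Fintype E] in
theorem Integ.min_zero {g : (E → O) → ℝ} (hg : Integ p g) : Integ p fun φ => min (g φ) 0 :=
  hg.of_abs_le fun φ => by
    rcases le_total (g φ) 0 with h | h
    · rw [min_eq_left h]
    · rw [min_eq_right h, abs_zero]; exact abs_nonneg _

omit [Fintype E] in
theorem Integ.max_zero {g : (E → O) → ℝ} (hg : Integ p g) : Integ p fun φ => max (g φ) 0 :=
  hg.of_abs_le fun φ => by
    rcases le_total (g φ) 0 with h | h
    · rw [max_eq_right h, abs_zero]; exact abs_nonneg _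
    · rw [max_eq_left h]

/-- The negative marginal utilities cannot outweigh the current utility: selecting all items with
a negative marginal utility would otherwise make the utility negative. The set of these items
depends on the observed states only, so that the weight can be split accordingly. -/
theorem neg_mean_le_mean_sum_min (hf0 : ∀ S φ, 0 ≤ f S φ) (hf : ∀ S, Integ p (f S))
    (hs : AdaptiveSubmodular p f) {D : Finset E} {c : (E → O) → ℝ} (hc : Weight c D) :
    -mean p (fun φ => c φ * f D φ) ≤
      mean p fun φ => c φ * ∑ e, min (marginal p f {e} (restr D φ)) 0 := by
  let M : PartialRealization E O → Finset E :=
    fun ψ => Finset.univ.filter fun e => marginal p f {e} ψ < 0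
  let d : Finset E → (E → O) → ℝ := fun N φ => if M (restr D φ) = N then 1 else 0
  have hd : ∀ N, Weight (d N) D := fun N =>
    ⟨fun φ => by simp only [d]; split_ifs <;> simp,
      dependsOn_comp_restr D fun ψ => if M ψ = N then (1 : ℝ) else 0⟩
  have h1 : ∀ φ, c φ * ∑ e, min (marginal p f {e} (restr D φ)) 0 =
      ∑ N, (c φ * d N φ) * ∑ e ∈ N, marginal p f {e} (restr D φ) := fun φ => by
    rw [Finset.sum_eq_single (M (restr D φ))]
    · simp only [d, if_true, mul_one]
      congr 1
      rw [Finset.sum_filter]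
      refine Finset.sum_congr rfl fun e _ => ?_
      split_ifs with h
      · exact min_eq_left h.le
      · exact min_eq_right (not_lt.1 h)
    · intro N _ hN
      simp [d, hN.symm]
    · simp
  have h2 : ∀ φ, c φ * f D φ = ∑ N, (c φ * d N φ) * f D φ := fun φ => by
    rw [← Finset.sum_mul, ← Finset.mul_sum]
    simp [d]
  have hw : ∀ N, Weight (fun φ => c φ * d N φ) D := fun N => hc.mul (hd N)
  simp only [h1, h2]
  rw [mean_sum fun N _ => (hf D).weight_mul (hw N).mem_Icc,
    mean_sum fun N _ => (Integ.sum fun e _ => integ_marginal hf D e).weight_mul (hw N).mem_Icc,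
    ← Finset.sum_neg_distrib]
  refine Finset.sum_le_sum fun N _ => le_trans ?_ (mean_union_sub_le hf hs (hw N) N)
  simp only [mul_sub]
  rw [mean_sub ((hf _).weight_mul (hw N).mem_Icc) ((hf _).weight_mul (hw N).mem_Icc)]
  have := mean_nonneg (p := p) fun φ => mul_nonneg ((hw N).mem_Icc φ).1 (hf0 (D ∪ N) φ)
  linarith

/-! ### Random extensions by one item -/

/-- `D` together with the item that is selected, if any. -/
def addOpt (a : Option E) (D : Finset E) : Finset E := a.elim D fun e => insert e D

theorem ev_addOpt (μ : PMF (Option E)) (D : Finset E) (g : Finset E → ℝ) :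
    ev μ (fun a => g (addOpt a D)) =
      g D + ∑ e, (μ (some e)).toReal * (g (insert e D) - g D) :=
  ev_option _ _

theorem mean_weight_mul_ev_addOpt (hf : ∀ S, Integ p (f S))
    (κ : PartialRealization E O → PMF (Option E)) {A D : Finset E} (hAD : A ⊆ D)
    {c : (E → O) → ℝ} (hc : Weight c D) :
    mean p (fun φ => c φ * ev (κ (restr A φ)) fun a => f (addOpt a D) φ) =
      mean p (fun φ => c φ * f D φ) + mean p fun φ =>
        c φ * ∑ e, (κ (restr A φ) (some e)).toReal * marginal p f {e} (restr D φ) := by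
  have hw : ∀ e, Weight (fun φ => c φ * (κ (restr A φ) (some e)).toReal) D := fun e =>
    hc.mul ((weight_restr κ (some e) A).mono hAD)
  have h1 : ∀ φ, c φ * ev (κ (restr A φ)) (fun a => f (addOpt a D) φ) =
      c φ * f D φ + ∑ e, c φ * (κ (restr A φ) (some e)).toReal * (f (insert e D) φ - f D φ) :=
    fun φ => by rw [ev_addOpt _ D fun S => f S φ, mul_add, Finset.mul_sum]; simp only [mul_assoc]
  simp only [h1, Finset.mul_sum, ← mul_assoc]
  rw [mean_add ((hf D).weight_mul hc.mem_Icc)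
      (Integ.sum fun e _ => ((hf _).sub (hf _)).weight_mul (hw e).mem_Icc),
    mean_sum fun e _ => ((hf _).sub (hf _)).weight_mul (hw e).mem_Icc,
    mean_sum fun e _ => (integ_marginal hf D e).weight_mul (hw e).mem_Icc]
  congr 1
  exact Finset.sum_congr rfl fun e _ => (mean_weight_mul_marginal hf (hw e) e).symm

/-- Adding a random item, chosen from the observations in `A` so that each item has probability
at most `q`, loses at most a fraction `q` of the expected utility. -/
theorem mean_ev_addOpt_ge (hf0 : ∀ S φ, 0 ≤ f S φ) (hf : ∀ S, Integ p (f S))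
    (hs : AdaptiveSubmodular p f) {κ : PartialRealization E O → PMF (Option E)} {q : ℝ} (hq0 : 0 ≤ q)
    (hq : ∀ ψ e, (κ ψ (some e)).toReal ≤ q) {A D : Finset E} (hAD : A ⊆ D)
    {c : (E → O) → ℝ} (hc : Weight c D) :
    (1 - q) * mean p (fun φ => c φ * f D φ) ≤
      mean p fun φ => c φ * ev (κ (restr A φ)) fun a => f (addOpt a D) φ := by
  rw [mean_weight_mul_ev_addOpt hf κ hAD hc]
  have h1 : mean p (fun φ => q * (c φ * ∑ e, min (marginal p f {e} (restr D φ)) 0)) ≤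
      mean p fun φ => c φ * ∑ e, (κ (restr A φ) (some e)).toReal *
        marginal p f {e} (restr D φ) := by
    refine mean_mono (((Integ.sum fun e _ => (integ_marginal hf D e).min_zero).weight_mul
      hc.mem_Icc).const_mul q) ((Integ.sum fun e _ => (integ_marginal hf D e).weight_mul fun _ =>
      toReal_mem_Icc _ _).weight_mul hc.mem_Icc) fun φ _ => ?_
    rw [mul_left_comm, Finset.mul_sum]
    refine mul_le_mul_of_nonneg_left (Finset.sum_le_sum fun e _ => ?_) (hc.mem_Icc φ).1
    calc q * min (marginal p f {e} (restr D φ)) 0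
        ≤ (κ (restr A φ) (some e)).toReal * min (marginal p f {e} (restr D φ)) 0 :=
          mul_le_mul_of_nonpos_right (hq _ _) (min_le_right _ _)
      _ ≤ _ := mul_le_mul_of_nonneg_left (min_le_left _ _) ENNReal.toReal_nonneg
  rw [mean_const_mul] at h1
  have h2 := mul_le_mul_of_nonneg_left (neg_mean_le_mean_sum_min hf0 hf hs hc) hq0
  linarith

end submodular

/-! ### Adaptive policies -/

/-- Law of the set of items that have been selected when `π` is run under `φ` from `ψ` on, for at
most `t` more selections. -/
def Policy.law (π : Policy E O) (φ : E → O) (t : ℕ) (ψ : PartialRealization E O) :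
    PMF (Finset E) := (π.runFrom φ t ψ).map dom

theorem Policy.law_zero (π : Policy E O) (φ : E → O) (ψ : PartialRealization E O) :
    π.law φ 0 ψ = PMF.pure (dom ψ) := by
  rw [law, runFrom, PMF.pure_map]

theorem Policy.law_succ (π : Policy E O) (φ : E → O) (t : ℕ) (ψ : PartialRealization E O) :
    π.law φ (t + 1) ψ = (π.next ψ).bind fun a =>
      a.elim (PMF.pure (dom ψ)) fun e => π.law φ t (observe ψ e (φ e)) := by
  rw [law, runFrom, PMF.map_bind]
  congr 1
  ext1 a
  cases a
  · simp [PMF.pure_map]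
  · rfl

theorem mem_dom (ψ : PartialRealization E O) (e : E) : e ∈ dom ψ ↔ (ψ e).isSome := by
  simp [dom]

theorem dom_observe (ψ : PartialRealization E O) (e : E) (o : O) :
    dom (observe ψ e o) = insert e (dom ψ) := by
  ext x
  by_cases h : x = e
  · subst h; simp [mem_dom, observe]
  · simp [mem_dom, observe, h]

theorem Policy.dom_subset_of_law_ne_zero (π : Policy E O) (φ : E → O) (t : ℕ)
    (ψ : PartialRealization E O) {S : Finset E} (h : π.law φ t ψ S ≠ 0) : dom ψ ⊆ S := by
  induction t generalizing ψ with
  | zero =>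
    rw [law_zero, ← PMF.mem_support_iff, PMF.mem_support_pure_iff] at h
    rw [h]
  | succ t ih =>
    rw [law_succ, ← PMF.mem_support_iff, PMF.mem_support_bind_iff] at h
    obtain ⟨a, -, ha⟩ := h
    cases a with
    | none =>
      rw [Option.elim_none, PMF.mem_support_pure_iff] at ha
      rw [ha]
    | some e =>
      have := ih _ ((PMF.mem_support_iff _ _).1 ha)
      rw [dom_observe] at this
      exact (Finset.subset_insert _ _).trans this

/-- The probability that exactly the items of `S` are selected depends only on the states of the
items of `S`, as no other states are ever observed in this case. -/
theorem Policy.law_apply_congr (π : Policy E O) {φ φ' : E → O} {S : Finset E}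
    (h : ∀ e ∈ S, φ e = φ' e) (t : ℕ) (ψ : PartialRealization E O) :
    π.law φ t ψ S = π.law φ' t ψ S := by
  induction t generalizing ψ with
  | zero => rw [law_zero, law_zero]
  | succ t ih =>
    rw [law_succ, law_succ, PMF.bind_apply, PMF.bind_apply]
    refine tsum_congr fun a => ?_
    congr 1
    cases a with
    | none => rfl
    | some e =>
      by_cases he : e ∈ S
      · rw [Option.elim_some, Option.elim_some, h e he, ih]
      · have h0 : ∀ φ'' : E → O, π.law φ'' t (observe ψ e (φ'' e)) S = 0 := fun φ'' => by
          by_contra h0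
          have := π.dom_subset_of_law_ne_zero _ _ _ h0
          rw [dom_observe] at this
          exact he (this (Finset.mem_insert_self _ _))
        rw [Option.elim_some, Option.elim_some, h0, h0]

theorem Policy.selected_eq_law (π : Policy E O) (φ : E → O) :
    π.selected φ = π.law φ (Fintype.card E) (restr ∅ φ) := by
  rw [restr_empty]; rfl

theorem Policy.weight_selected (π : Policy E O) (S : Finset E) :
    Weight (fun φ => (π.selected φ S).toReal) S :=
  ⟨fun _ => toReal_mem_Icc _ _, fun φ φ' h => by
    show (π.selected φ S).toReal = (π.selected φ' S).toReal
    unfold selected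
    exact congrArg ENNReal.toReal (π.law_apply_congr h _ _)⟩

section

variable {p : PMF (E → O)} {f : Finset E → (E → O) → ℝ}

/-- A potential that does not increase in expectation when a new item is selected on the basis
of the observations does not increase during the run of a policy. Here the states of the items
of `A` are known from the start. -/
theorem Policy.mean_law_le (π : Policy E O) {A : Finset E} {G : Finset E → (E → O) → ℝ}
    (hG : ∀ S, Integ p (G S))
    (hstep : ∀ (B : Finset E) (e : E) (c : (E → O) → ℝ), e ∉ B → Weight c (A ∪ B) →
      mean p (fun φ => c φ * G (insert e B) φ) ≤ mean p fun φ => c φ * G B φ)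
    (t : ℕ) (B : Finset E) {c : (E → O) → ℝ} (hc : Weight c (A ∪ B)) :
    mean p (fun φ => c φ * ev (π.law φ t (restr B φ)) fun S => G S φ) ≤
      mean p fun φ => c φ * G B φ := by
  induction t generalizing B c with
  | zero => simp only [law_zero, dom_restr, ev_pure, le_refl]
  | succ t ih =>
    have hw : ∀ a, Weight (fun φ => c φ * (π.next (restr B φ) a).toReal) (A ∪ B) := fun a =>
      hc.mul ((weight_restr π.next a B).mono Finset.subset_union_right)
    let H : Option E → (E → O) → ℝ := fun a φ =>
      a.elim (G B φ) fun e => ev (π.law φ t (restr (insert e B) φ)) fun S => G S φ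
    have hH : ∀ a, Integ p (H a) := fun a => by
      cases a with
      | none => exact hG B
      | some e => exact Integ.ev hG
    have h1 : ∀ φ, c φ * ev (π.law φ (t + 1) (restr B φ)) (fun S => G S φ) =
        ∑ a, (c φ * (π.next (restr B φ) a).toReal) * H a φ := fun φ => by
      rw [law_succ, ev_bind, ev, Finset.mul_sum]
      refine Finset.sum_congr rfl fun a _ => ?_
      rw [mul_assoc]
      congr 2
      cases a with
      | none => simp only [Option.elim_none, ev_pure, dom_restr, H]
      | some e => simp only [Option.elim_some, observe_restr, H]
    have h2 : ∀ φ, c φ * G B φ = ∑ a, (c φ * (π.next (restr B φ) a).toReal) * G B φ :=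
      fun φ => by rw [← Finset.sum_mul, ← Finset.mul_sum, sum_toReal, mul_one]
    simp only [h1, h2]
    rw [mean_sum fun a _ => (hH a).weight_mul (hw a).mem_Icc,
      mean_sum fun a _ => (hG B).weight_mul (hw a).mem_Icc]
    refine Finset.sum_le_sum fun a _ => ?_
    cases a with
    | none => exact le_rfl
    | some e =>
      by_cases he : e ∈ B
      · have h0 : ∀ φ : E → O, (π.next (restr B φ) (some e)).toReal = 0 := fun φ => by
          rw [(PMF.apply_eq_zero_iff _ _).2 fun h => ?_, ENNReal.toReal_zero]
          exact π.fresh _ _ h (by rwa [dom_restr])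
        simp only [h0, mul_zero, zero_mul, le_refl]
      · refine (ih (insert e B) ((hw (some e)).mono ?_)).trans (hstep B e _ he (hw (some e)))
        exact Finset.union_subset_union_right (Finset.subset_insert _ _)

/-- When a policy is run on top of the items of `A`, whose states are known, its expected gain
is at most the expected sum of the nonnegative parts of the initial marginal utilities of the
items it selects. -/
theorem Policy.mean_gain_le (π : Policy E O) (hf : ∀ S, Integ p (f S))
    (hs : AdaptiveSubmodular p f) {A : Finset E} {c : (E → O) → ℝ} (hc : Weight c A) :
    mean p (fun φ => c φ * ev (π.selected φ) fun S => f (A ∪ S) φ) - mean p (fun φ => c φ * f A φ)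
      ≤ mean p fun φ => c φ * ev (π.selected φ) fun S =>
        ∑ e ∈ S, max (marginal p f {e} (restr A φ)) 0 := by
  have hW : ∀ S : Finset E, Integ p fun φ => ∑ e ∈ S, max (marginal p f {e} (restr A φ)) 0 :=
    fun S => Integ.sum fun e _ => (integ_marginal hf A e).max_zero
  have h := π.mean_law_le (p := p) (A := A)
    (G := fun S φ => f (A ∪ S) φ - ∑ e ∈ S, max (marginal p f {e} (restr A φ)) 0)
    (fun S => (hf _).sub (hW S)) ?_ (Fintype.card E) ∅ (c := c) (by simpa using hc)
  · simp only [← selected_eq_law, ev_sub, mul_sub, Finset.union_empty, Finset.sum_empty,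
      sub_zero] at h
    rw [mean_sub ((Integ.ev fun S => hf (A ∪ S)).weight_mul hc.mem_Icc)
      ((Integ.ev hW).weight_mul hc.mem_Icc)] at h
    linarith
  · intro B e c he hc
    have h1 : ∀ φ, c φ * (f (A ∪ insert e B) φ -
        ∑ e ∈ insert e B, max (marginal p f {e} (restr A φ)) 0) =
        c φ * (f (A ∪ B) φ - ∑ e ∈ B, max (marginal p f {e} (restr A φ)) 0) +
        (c φ * (f (insert e (A ∪ B)) φ - f (A ∪ B) φ) -
          c φ * max (marginal p f {e} (restr A φ)) 0) := fun φ => by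
      rw [Finset.sum_insert he, Finset.union_insert]; ring
    have hI := ((hf (insert e (A ∪ B))).sub (hf (A ∪ B))).weight_mul hc.mem_Icc
    have hm := (integ_marginal (p := p) hf A e).max_zero.weight_mul hc.mem_Icc
    simp only [h1]
    rw [mean_add (((hf _).sub (hW B)).weight_mul hc.mem_Icc) (hI.sub hm), mean_sub hI hm,
      ← mean_weight_mul_marginal hf hc e]
    have h2 : mean p (fun φ => c φ * marginal p f {e} (restr (A ∪ B) φ)) ≤
        mean p fun φ => c φ * max (marginal p f {e} (restr A φ)) 0 := by
      refine mean_mono ((integ_marginal hf _ e).weight_mul hc.mem_Icc) hm fun φ hφ =>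
        mul_le_mul_of_nonneg_left ?_ (hc.mem_Icc φ).1
      by_cases heA : e ∈ A ∪ B
      · rw [marginal_of_mem heA]; exact le_max_right _ _
      · exact (marginal_restr_anti hs Finset.subset_union_left heA hφ).trans (le_max_left _ _)
    linarith

/-! ### Greedy processes -/

/-- Law of the set of selected items when, `r` times in a row, an item is drawn with the law `κ`
on the basis of the observed states and selected, starting from the selected set `A`. -/
def greedyLaw (κ : PartialRealization E O → PMF (Option E)) (φ : E → O) :
    ℕ → Finset E → PMF (Finset E)
  | 0, A => PMF.pure A
  | r + 1, A => (κ (restr A φ)).bind fun a => greedyLaw κ φ r (addOpt a A)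

/-- One step of a greedy process that collects at least the fraction `θ` of the marginal
utilities of any `k` items recovers the fraction `θ` of the gap to any feasible policy. -/
theorem mean_ev_addOpt_ge_of_greedy (hf : ∀ S, Integ p (f S)) (hs : AdaptiveSubmodular p f)
    {κ : PartialRealization E O → PMF (Option E)} {k : ℕ} {θ : ℝ} (hθ : 0 ≤ θ)
    (hκ : ∀ ψ (S : Finset E), S.card ≤ k → θ * ∑ e ∈ S, max (marginal p f {e} ψ) 0 ≤
      ∑ e, (κ ψ (some e)).toReal * marginal p f {e} ψ)
    {π : Policy E O} (hπ : π.Feasible k) {A : Finset E} {c : (E → O) → ℝ} (hc : Weight c A) :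
    (1 - θ) * mean p (fun φ => c φ * f A φ) +
        θ * mean p (fun φ => c φ * ev (π.selected φ) fun S => f (A ∪ S) φ) ≤
      mean p fun φ => c φ * ev (κ (restr A φ)) fun a => f (addOpt a A) φ := by
  rw [mean_weight_mul_ev_addOpt hf κ subset_rfl hc]
  have h1 := mul_le_mul_of_nonneg_left (π.mean_gain_le hf hs hc) hθ
  rw [← mean_const_mul (p := p) θ (g := fun φ => c φ * ev (π.selected φ) fun S =>
        ∑ e ∈ S, max (marginal p f {e} (restr A φ)) 0)] at h1
  have h2 := h1.trans (mean_mono (h := fun φ =>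
      c φ * ∑ e, (κ (restr A φ) (some e)).toReal * marginal p f {e} (restr A φ))
    (((Integ.ev fun S => Integ.sum fun e _ => (integ_marginal hf A e).max_zero).weight_mul
      hc.mem_Icc).const_mul θ)
    ((Integ.sum fun e _ => (integ_marginal hf A e).weight_mul fun _ =>
      toReal_mem_Icc _ _).weight_mul hc.mem_Icc) fun φ _ => by
        rw [mul_left_comm]
        refine mul_le_mul_of_nonneg_left ?_ (hc.mem_Icc φ).1
        rw [← ev_const_mul]
        exact (ev_mono fun S hS => hκ _ S (hπ φ S hS)).trans_eq (ev_const _ _))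
  linarith

omit [Fintype E] in
theorem addOpt_union (a : Option E) (A S : Finset E) : addOpt a A ∪ S = addOpt a (A ∪ S) := by
  cases a <;> simp [addOpt]

/-- The expected value of a policy that is run on top of the selected set decreases slowly. -/
theorem mean_ev_policy_addOpt_ge (hf0 : ∀ S φ, 0 ≤ f S φ) (hf : ∀ S, Integ p (f S))
    (hs : AdaptiveSubmodular p f) {κ : PartialRealization E O → PMF (Option E)} {q : ℝ}
    (hq0 : 0 ≤ q) (hq : ∀ ψ e, (κ ψ (some e)).toReal ≤ q) (π : Policy E O) {A : Finset E}
    {c : (E → O) → ℝ} (hc : Weight c A) :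
    (1 - q) * mean p (fun φ => c φ * ev (π.selected φ) fun S => f (A ∪ S) φ) ≤
      mean p fun φ => c φ * ev (κ (restr A φ)) fun a =>
        ev (π.selected φ) fun S => f (addOpt a A ∪ S) φ := by
  have hw : ∀ S, Weight (fun φ => c φ * (π.selected φ S).toReal) (A ∪ S) := fun S =>
    (hc.mono Finset.subset_union_left).mul
      ((π.weight_selected S).mono Finset.subset_union_right)
  have h1 : ∀ φ, c φ * ev (π.selected φ) (fun S => f (A ∪ S) φ) =
      ∑ S, (c φ * (π.selected φ S).toReal) * f (A ∪ S) φ := fun φ => by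
    rw [ev, Finset.mul_sum]; simp only [mul_assoc]
  have h2 : ∀ φ, c φ * ev (κ (restr A φ)) (fun a =>
        ev (π.selected φ) fun S => f (addOpt a A ∪ S) φ) =
      ∑ S, (c φ * (π.selected φ S).toReal) *
        ev (κ (restr A φ)) fun a => f (addOpt a (A ∪ S)) φ := fun φ => by
    simp only [ev, addOpt_union, Finset.mul_sum]
    rw [Finset.sum_comm]
    refine Finset.sum_congr rfl fun S _ => Finset.sum_congr rfl fun a _ => by ring
  simp only [h1, h2]
  rw [mean_sum fun S _ => (hf _).weight_mul (hw S).mem_Icc,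
    mean_sum fun S _ => (Integ.ev fun a => hf _).weight_mul (hw S).mem_Icc, Finset.mul_sum]
  exact Finset.sum_le_sum fun S _ =>
    mean_ev_addOpt_ge hf0 hf hs hq0 hq Finset.subset_union_left (hw S)

/-- The value of `r` greedy steps, compared with the current utility and with the utility of a
feasible policy on top of the current selection. -/
theorem mean_greedyLaw_ge (hf0 : ∀ S φ, 0 ≤ f S φ) (hf : ∀ S, Integ p (f S))
    (hs : AdaptiveSubmodular p f) {κ : PartialRealization E O → PMF (Option E)} {k : ℕ}
    {q θ : ℝ} (hq0 : 0 ≤ q) (hq1 : q ≤ 1) (hq : ∀ ψ e, (κ ψ (some e)).toReal ≤ q)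
    (hθ : 0 ≤ θ) (hθq : θ ≤ q)
    (hκ : ∀ ψ (S : Finset E), S.card ≤ k → θ * ∑ e ∈ S, max (marginal p f {e} ψ) 0 ≤
      ∑ e, (κ ψ (some e)).toReal * marginal p f {e} ψ)
    {π : Policy E O} (hπ : π.Feasible k) (r : ℕ) (A : Finset E) {c : (E → O) → ℝ}
    (hc : Weight c A) :
    (1 - q) ^ r * mean p (fun φ => c φ * f A φ) + r * θ * (1 - q) ^ (r - 1) *
        mean p (fun φ => c φ * ev (π.selected φ) fun S => f (A ∪ S) φ) ≤
      mean p fun φ => c φ * ev (greedyLaw κ φ r A) fun S => f S φ := by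
  induction r generalizing A c with
  | zero => simp [greedyLaw, ev_pure]
  | succ r ih =>
    have hw : ∀ a, Weight (fun φ => c φ * (κ (restr A φ) a).toReal) A := fun a =>
      hc.mul (weight_restr κ a A)
    have hexp : ∀ G : Option E → (E → O) → ℝ, (∀ a, Integ p (G a)) →
        mean p (fun φ => c φ * ev (κ (restr A φ)) fun a => G a φ) =
          ∑ a, mean p fun φ => (c φ * (κ (restr A φ) a).toReal) * G a φ := fun G hG => by
      rw [← mean_sum fun a _ => (hG a).weight_mul (hw a).mem_Icc]
      congr 1; ext1 φ
      rw [ev, Finset.mul_sum]; simp only [mul_assoc]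
    have hsub : ∀ a : Option E, A ⊆ addOpt a A := fun a => by
      cases a <;> simp [addOpt]
    have hI : ∀ A : Finset E, Integ p fun φ => ev (π.selected φ) fun S => f (A ∪ S) φ :=
      fun A => Integ.ev fun S => hf _
    have h1 := mean_ev_addOpt_ge_of_greedy hf hs hθ hκ hπ hc
    have h2 := mean_ev_policy_addOpt_ge hf0 hf hs hq0 hq π hc
    have hsum := Finset.sum_le_sum fun a (_ : a ∈ Finset.univ) =>
      ih (addOpt a A) ((hw a).mono (hsub a))
    simp only [Finset.sum_add_distrib, ← Finset.mul_sum] at hsum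
    rw [← hexp (fun a => f (addOpt a A)) fun a => hf _,
      ← hexp (fun a φ => ev (π.selected φ) fun S => f (addOpt a A ∪ S) φ) fun a => hI _,
      ← hexp (fun a φ => ev (greedyLaw κ φ r (addOpt a A)) fun S => f S φ)
        fun a => Integ.ev hf] at hsum
    simp only [greedyLaw, ev_bind]
    refine le_trans ?_ hsum
    -- Both potentials are linear in the state, so that the one-step bounds combine; the factor
    -- `1 - θ` of the utility is weakened to `1 - q`.
    have hg : 0 ≤ mean p fun φ => c φ * f A φ :=
      mean_nonneg fun φ => mul_nonneg (hc.mem_Icc φ).1 (hf0 _ _)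
    have hq' : 0 ≤ 1 - q := by linarith
    have e1 := mul_le_mul_of_nonneg_left h1 (pow_nonneg hq' r)
    have e2 := mul_le_mul_of_nonneg_left h2
      (mul_nonneg (mul_nonneg (Nat.cast_nonneg r) hθ) (pow_nonneg hq' (r - 1)))
    have e3 := mul_le_mul_of_nonneg_right (show 1 - q ≤ 1 - θ by linarith) hg
    have e4 := mul_le_mul_of_nonneg_left e3 (pow_nonneg hq' r)
    have e5 : (r : ℝ) * θ * (1 - q) ^ (r - 1) * (1 - q) = r * θ * (1 - q) ^ r := by
      cases r with
      | zero => simp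
      | succ r => rw [Nat.add_sub_cancel, pow_succ]; ring
    rw [← mul_assoc, e5] at e2
    refine le_trans (le_of_eq ?_) (add_le_add (le_trans (add_le_add_left e4 _) (le_trans
      (le_of_eq (mul_add _ _ _).symm) e1)) e2)
    rw [Nat.add_sub_cancel]
    push_cast
    ring

end

/-! ### Uniformly random subsets -/

theorem ev_uniformSubset {m : ℕ} (hm : m ≤ Fintype.card E) (g : Finset E → ℝ) :
    ev (uniformSubset E m hm) g =
      ((Fintype.card E).choose m : ℝ)⁻¹ * ∑ S ∈ Finset.powersetCard m Finset.univ, g S := by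
  rw [ev, Finset.mul_sum, ← Finset.sum_subset (Finset.subset_univ (Finset.powersetCard m _))]
  · refine Finset.sum_congr rfl fun S hS => ?_
    rw [uniformSubset, PMF.uniformOfFinset_apply_of_mem _ hS, Finset.card_powersetCard,
      Finset.card_univ, ENNReal.toReal_inv, ENNReal.toReal_natCast]
  · intro S _ hS
    rw [uniformSubset, PMF.uniformOfFinset_apply_of_notMem _ hS, ENNReal.toReal_zero, zero_mul]

theorem card_of_mem_support_uniformSubset {m : ℕ} (hm : m ≤ Fintype.card E) {S : Finset E}
    (h : S ∈ (uniformSubset E m hm).support) : S.card = m := by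
  rw [uniformSubset, PMF.mem_support_uniformOfFinset_iff] at h
  exact (Finset.mem_powersetCard.1 h).2

theorem ev_uniformSubset_subset {m : ℕ} (hm : m ≤ Fintype.card E) (T : Finset E) :
    ev (uniformSubset E m hm) (fun S => if T ⊆ S then 1 else 0) =
      ((Fintype.card E).choose m : ℝ)⁻¹ *
        if T.card ≤ m then (((Fintype.card E - T.card).choose (m - T.card) : ℕ) : ℝ) else 0 := by
  rw [ev_uniformSubset, ← Finset.sum_filter, Finset.sum_const, nsmul_eq_mul, mul_one]
  congr 1
  split_ifs with h
  · rw [Finset.card_filter_powersetCard_subset _ _ _ (Finset.subset_univ _) h, Finset.card_univ]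
  · rw [Finset.card_eq_zero.2, Nat.cast_zero]
    refine Finset.filter_eq_empty_iff.2 fun S hS hT => h ?_
    rw [← (Finset.mem_powersetCard.1 hS).2]
    exact Finset.card_le_card hT

theorem choose_sub_one {n m : ℕ} (hm : 1 ≤ m) (hmn : m ≤ n) :
    (n : ℝ) * ((n - 1).choose (m - 1) : ℕ) = m * (n.choose m : ℕ) := by
  obtain ⟨n, rfl⟩ : ∃ a, n = a + 1 := ⟨n - 1, by omega⟩
  obtain ⟨m, rfl⟩ : ∃ a, m = a + 1 := ⟨m - 1, by omega⟩
  have := Nat.add_one_mul_choose_eq n m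
  rw [Nat.add_sub_cancel, Nat.add_sub_cancel, mul_comm ((m + 1 : ℕ) : ℝ)]
  exact_mod_cast this

/-- Every item lies in a uniformly random `m`-set with probability `m / n`. -/
theorem ev_uniformSubset_mem {m : ℕ} (hm : m ≤ Fintype.card E) (e : E) :
    ev (uniformSubset E m hm) (fun S => if e ∈ S then 1 else 0) = m / Fintype.card E := by
  have h := ev_uniformSubset_subset hm {e}
  simp only [Finset.singleton_subset_iff, Finset.card_singleton] at h
  rw [h]
  have hn : (0 : ℝ) < Fintype.card E := by
    exact_mod_cast Fintype.card_pos_iff.2 ⟨e⟩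
  have hC : (0 : ℝ) < ((Fintype.card E).choose m : ℕ) := by exact_mod_cast Nat.choose_pos hm
  split_ifs with h1
  · have := choose_sub_one h1 hm
    field_simp
    linarith
  · obtain rfl : m = 0 := by omega
    simp

/-- Two distinct items are negatively correlated in a uniformly random `m`-set. -/
theorem ev_uniformSubset_pair_le {m : ℕ} (hm : m ≤ Fintype.card E) {e e' : E} (h : e ≠ e') :
    ev (uniformSubset E m hm) (fun S => if e ∈ S ∧ e' ∈ S then 1 else 0) ≤
      (m / Fintype.card E) ^ 2 := by
  have h0 := ev_uniformSubset_subset hm {e, e'}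
  simp only [Finset.insert_subset_iff, Finset.singleton_subset_iff, Finset.card_pair h] at h0
  rw [h0]
  have hn2 : 2 ≤ Fintype.card E := by
    rw [← Finset.card_pair h]; exact Finset.card_le_univ _
  have hC : (0 : ℝ) < ((Fintype.card E).choose m : ℕ) := by exact_mod_cast Nat.choose_pos hm
  split_ifs with h1
  · have a1 := choose_sub_one (n := Fintype.card E) (m := m) (by omega) hm
    have a2 := choose_sub_one (n := Fintype.card E - 1) (m := m - 1) (by omega) (by omega)
    rw [Nat.sub_sub, Nat.sub_sub, Nat.cast_sub (by omega), Nat.cast_sub (by omega)] at a2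
    push_cast at a2
    generalize ((Fintype.card E - (1 + 1)).choose (m - (1 + 1)) : ℕ) = x at *
    generalize ((Fintype.card E - 1).choose (m - 1) : ℕ) = y at *
    generalize ((Fintype.card E).choose m : ℕ) = z at *
    have hn2' : (2 : ℝ) ≤ Fintype.card E := by exact_mod_cast hn2
    have hm' : (m : ℝ) ≤ Fintype.card E := by exact_mod_cast hm
    have hm2 : (2 : ℝ) ≤ m := by exact_mod_cast h1
    generalize (Fintype.card E : ℝ) = n at *
    generalize (m : ℝ) = m at *
    have hx : (x : ℝ) * (n * (n - 1)) = m * (m - 1) * z := by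
      linear_combination n * a2 + (m - 1) * a1
    rw [inv_mul_le_iff₀ hC, div_pow, ← mul_div_assoc, le_div_iff₀ (by positivity)]
    have hx2 : (x : ℝ) * n ^ 2 * (n - 1) = m * (m - 1) * z * n := by linear_combination n * hx
    have : m * (m - 1) * z * n ≤ z * m ^ 2 * (n - 1) := by
      have : 0 ≤ m * z * (n - m) := by
        have := hC.le
        have : 0 ≤ n - m := by linarith
        positivity
      nlinarith
    exact le_of_mul_le_mul_right (hx2.trans_le this) (by linarith)
  · rw [mul_zero]; positivity

omit [Fintype E] in
theorem sum_if_mem (S M : Finset E) (w : E → ℝ) :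
    ∑ e ∈ M, (if e ∈ S then w e else 0) = ∑ e ∈ S ∩ M, w e := by
  rw [← Finset.sum_filter, Finset.filter_mem_eq_inter, Finset.inter_comm]

theorem ev_finset_sum {α ι : Type*} [Fintype α] (μ : PMF α) (s : Finset ι) (g : ι → α → ℝ) :
    ev μ (fun a => ∑ i ∈ s, g i a) = ∑ i ∈ s, ev μ (g i) := by
  simp only [ev, Finset.mul_sum]
  exact Finset.sum_comm

theorem ev_card_inter {m : ℕ} (hm : m ≤ Fintype.card E) (M : Finset E) :
    ev (uniformSubset E m hm) (fun S => ((S ∩ M).card : ℝ)) = M.card * (m / Fintype.card E) := by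
  have h : ∀ S : Finset E, ((S ∩ M).card : ℝ) = ∑ e ∈ M, if e ∈ S then (1 : ℝ) else 0 :=
    fun S => by rw [sum_if_mem]; simp
  simp only [h]
  rw [ev_finset_sum]
  simp only [ev_uniformSubset_mem, Finset.sum_const, nsmul_eq_mul]

theorem ev_card_inter_sq_le {m : ℕ} (hm : m ≤ Fintype.card E) (M : Finset E) :
    ev (uniformSubset E m hm) (fun S => ((S ∩ M).card : ℝ) ^ 2) ≤
      M.card * (m / Fintype.card E) + (M.card * (m / Fintype.card E)) ^ 2 := by
  have h : ∀ S : Finset E, ((S ∩ M).card : ℝ) ^ 2 =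
      ∑ e ∈ M, ∑ e' ∈ M, if e ∈ S ∧ e' ∈ S then (1 : ℝ) else 0 := fun S => by
    have : ((S ∩ M).card : ℝ) = ∑ e ∈ M, if e ∈ S then (1 : ℝ) else 0 := by
      rw [sum_if_mem]; simp
    rw [sq, this, Finset.sum_mul_sum]
    refine Finset.sum_congr rfl fun e _ => Finset.sum_congr rfl fun e' _ => ?_
    by_cases h1 : e ∈ S <;> by_cases h2 : e' ∈ S <;> simp [h1, h2]
  simp only [h]
  rw [ev_finset_sum]
  simp only [ev_finset_sum]
  have h2 : ∀ e ∈ M, ∀ e' ∈ M,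
      ev (uniformSubset E m hm) (fun S => if e ∈ S ∧ e' ∈ S then (1 : ℝ) else 0) ≤
        (if e = e' then (m / Fintype.card E : ℝ) else 0) + (m / Fintype.card E : ℝ) ^ 2 := by
    intro e _ e' _
    split_ifs with he
    · subst he
      simp only [and_self, ev_uniformSubset_mem]
      linarith [sq_nonneg (m / Fintype.card E : ℝ)]
    · rw [zero_add]; exact ev_uniformSubset_pair_le hm he
  refine (Finset.sum_le_sum fun e he => Finset.sum_le_sum (h2 e he)).trans (le_of_eq ?_)
  have h3 : ∀ e ∈ M, ∑ e' ∈ M, ((if e = e' then (m / Fintype.card E : ℝ) else 0) +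
      (m / Fintype.card E : ℝ) ^ 2) =
        m / Fintype.card E + M.card * (m / Fintype.card E : ℝ) ^ 2 := fun e he => by
    rw [Finset.sum_add_distrib, Finset.sum_ite_eq, if_pos he, Finset.sum_const, nsmul_eq_mul]
  rw [Finset.sum_congr rfl h3, Finset.sum_const, nsmul_eq_mul]
  ring

/-- The number of items of `M` in a uniformly random `m`-set has mean `s = |M| m / n` and
variance at most `s`, so that truncating it at `s` costs little. The bound is
`min x s ≥ s - (s - x) / 2 - |s - x| / 2` with `|y| ≤ y² / (2 a) + a / 2` for `a = ε s`. -/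
theorem ev_min_card_inter_ge {m : ℕ} (hm : m ≤ Fintype.card E) (M : Finset E) {s ε : ℝ}
    (hs : s = M.card * (m / Fintype.card E)) (hε : 0 < ε) (hsε : 2 ≤ s * ε ^ 2) :
    (1 - ε) * s ≤ ev (uniformSubset E m hm) fun S => min ((S ∩ M).card : ℝ) s := by
  have hs0 : 0 < s := by
    by_contra h0
    have : s * ε ^ 2 ≤ 0 := mul_nonpos_of_nonpos_of_nonneg (not_lt.1 h0) (sq_nonneg _)
    linarith
  have ha : 0 < ε * s := mul_pos hε hs0
  have hpt : ∀ x : ℝ, (s / 2 - s ^ 2 / (4 * (ε * s)) - ε * s / 4) +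
      (1 / 2 + 2 * s / (4 * (ε * s))) * x - 1 / (4 * (ε * s)) * x ^ 2 ≤ min x s := fun x => by
    have e1 : (s / 2 - s ^ 2 / (4 * (ε * s)) - ε * s / 4) +
      (1 / 2 + 2 * s / (4 * (ε * s))) * x - 1 / (4 * (ε * s)) * x ^ 2 =
      (s + x) / 2 - ((s - x) ^ 2 + (ε * s) ^ 2) / (4 * (ε * s)) := by
      field_simp; ring
    have e2 : |s - x| / 2 ≤ ((s - x) ^ 2 + (ε * s) ^ 2) / (4 * (ε * s)) := by
      rw [le_div_iff₀ (by positivity), ← sq_abs (s - x)]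
      nlinarith [sq_nonneg (|s - x| - ε * s)]
    rw [e1, le_min_iff]
    constructor
    · linarith [le_abs_self (s - x)]
    · linarith [neg_abs_le (s - x)]
  refine le_trans ?_ (ev_mono fun S _ => hpt _)
  have hlin : ∀ (a b d : ℝ) (X : Finset E → ℝ),
      ev (uniformSubset E m hm) (fun S => a + b * X S - d * X S ^ 2) =
        a + b * ev (uniformSubset E m hm) X - d * ev (uniformSubset E m hm) (fun S => X S ^ 2) :=
    fun a b d X => by
      rw [ev_sub, ev_const_mul]
      congr 1
      have := ev_sub (uniformSubset E m hm) (fun _ => a) fun S => -b * X S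
      rw [ev_const, ev_const_mul] at this
      simpa [sub_eq_add_neg] using this
  rw [hlin, ev_card_inter, ← hs]
  have hv := ev_card_inter_sq_le hm M
  rw [← hs] at hv
  have hv' := mul_le_mul_of_nonneg_left hv (show 0 ≤ 1 / (4 * (ε * s)) by positivity)
  refine le_trans ?_ (sub_le_sub_left hv' _)
  have e3 : s / 2 - s ^ 2 / (4 * (ε * s)) - ε * s / 4 + (1 / 2 + 2 * s / (4 * (ε * s))) * s -
      1 / (4 * (ε * s)) * (s + s ^ 2) = s - ε * s / 4 - 1 / (4 * ε) := by
    field_simp; ring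
  rw [e3]
  have e4 : 1 / (4 * ε) ≤ ε * s / 8 := by
    rw [div_le_div_iff₀ (by positivity) (by norm_num)]
    nlinarith
  nlinarith

/-- By symmetry, the items of `M` contribute equally to an average that weighs a uniformly random
set by a function of the number of items of `M` it contains. -/
theorem ev_symm {m : ℕ} (hm : m ≤ Fintype.card E) (M : Finset E) (g : ℕ → ℝ) (w : E → ℝ) :
    M.card * ev (uniformSubset E m hm) (fun S => g (S ∩ M).card * ∑ e ∈ S ∩ M, w e) =
      (∑ e ∈ M, w e) *
        ev (uniformSubset E m hm) fun S => g (S ∩ M).card * ((S ∩ M).card : ℝ) := by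
  let b : E → ℝ := fun e => ev (uniformSubset E m hm) fun S =>
    if e ∈ S then g (S ∩ M).card else 0
  have hb : ∀ e ∈ M, ∀ e' ∈ M, b e = b e' := by
    intro e he e' he'
    simp only [b, ev_uniformSubset]
    congr 1
    let σ := Equiv.swap e e'
    have hσM : M.map σ.toEmbedding = M := by
      refine Finset.eq_of_subset_of_card_le (fun x hx => ?_) (by simp)
      obtain ⟨y, hy, rfl⟩ := Finset.mem_map.1 hx
      simp only [Equiv.coe_toEmbedding, σ]
      by_cases h1 : y = e
      · subst h1; simpa using he'
      · by_cases h2 : y = e'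
        · subst h2; simpa using he
        · rwa [Equiv.swap_apply_of_ne_of_ne h1 h2]
    refine Finset.sum_bijective (fun S : Finset E => S.map σ.toEmbedding)
      (Equiv.finsetCongr σ).bijective (fun S => by simp [Finset.mem_powersetCard]) fun S _ => ?_
    have h1 : e' ∈ S.map σ.toEmbedding ↔ e ∈ S := by
      rw [← Equiv.swap_apply_left e e']
      exact Finset.mem_map' σ.toEmbedding
    have h2 : (S.map σ.toEmbedding ∩ M).card = (S ∩ M).card := by
      conv_lhs => rw [← hσM, ← Finset.map_inter, Finset.card_map]
    simp only [h1, h2]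
  have hw : ∀ w : E → ℝ,
      ev (uniformSubset E m hm) (fun S => g (S ∩ M).card * ∑ e ∈ S ∩ M, w e) =
        ∑ e ∈ M, w e * b e := fun w => by
    have : ∀ S : Finset E, g (S ∩ M).card * ∑ e ∈ S ∩ M, w e =
        ∑ e ∈ M, w e * if e ∈ S then g (S ∩ M).card else 0 := fun S => by
      rw [← sum_if_mem, Finset.mul_sum]
      refine Finset.sum_congr rfl fun e _ => ?_
      split_ifs <;> ring
    simp only [this]
    rw [ev_finset_sum]
    simp only [ev_const_mul, b]
  have h1 : ev (uniformSubset E m hm) (fun S => g (S ∩ M).card * ((S ∩ M).card : ℝ)) =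
      ∑ e ∈ M, b e := by
    have := hw fun _ => 1
    simpa using this
  rw [hw, h1]
  rcases M.eq_empty_or_nonempty with rfl | ⟨e₀, he₀⟩
  · simp
  · have h2 : ∀ e ∈ M, b e = b e₀ := fun e he => hb e he e₀ he₀
    rw [Finset.sum_congr rfl h2, Finset.sum_congr rfl fun e he => by rw [h2 e he],
      ← Finset.sum_mul, Finset.sum_const, nsmul_eq_mul]
    ring

/-! ### The choice made in one round -/

theorem ceilUniform_apply {s : ℝ} (hs : 0 < s) (i : ℕ) :
    ceilUniform s i = (ENNReal.ofReal s)⁻¹ *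
      MeasureTheory.volume (Set.Ioc 0 s ∩ Nat.ceil ⁻¹' {i}) := by
  rw [ceilUniform, dif_pos hs, MeasureTheory.Measure.toPMF_apply,
    MeasureTheory.Measure.map_apply Nat.measurable_ceil (measurableSet_singleton _), uniformIoc,
    ProbabilityTheory.cond_apply measurableSet_Ioc, Real.volume_Ioc, sub_zero]

theorem ceilUniform_zero {s : ℝ} (hs : 0 < s) : ceilUniform s 0 = 0 := by
  have : Set.Ioc 0 s ∩ Nat.ceil ⁻¹' {0} = (∅ : Set ℝ) := by
    ext x
    simp only [Set.mem_inter_iff, Set.mem_Ioc, Set.mem_preimage, Set.mem_singleton_iff,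
      Nat.ceil_eq_zero, Set.mem_empty_iff_false, iff_false]
    intro h
    linarith [h.1.1, h.2]
  rw [ceilUniform_apply hs, this]
  simp

/-- The rank `⌈d⌉` equals `j + 1` with probability `|(j, j + 1] ∩ (0, s]| / s`. -/
theorem ceilUniform_succ {s : ℝ} (hs : 0 < s) (j : ℕ) :
    (ceilUniform s (j + 1)).toReal = (min s (j + 1) - min s j) / s := by
  have : Set.Ioc 0 s ∩ Nat.ceil ⁻¹' {j + 1} = Set.Ioc (j : ℝ) (min s (j + 1)) := by
    ext x
    simp only [Set.mem_inter_iff, Set.mem_Ioc, Set.mem_preimage, Set.mem_singleton_iff,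
      Nat.ceil_eq_iff (Nat.succ_ne_zero j), le_min_iff]
    have hj : (0 : ℝ) ≤ j := Nat.cast_nonneg j
    push_cast
    constructor
    · rintro ⟨⟨h1, h2⟩, h3, h4⟩; exact ⟨h3, h2, h4⟩
    · rintro ⟨h1, h2, h3⟩; exact ⟨⟨by linarith, h2⟩, h1, h3⟩
  rw [ceilUniform_apply hs, this, Real.volume_Ioc, ENNReal.toReal_mul, ENNReal.toReal_inv,
    ENNReal.toReal_ofReal hs.le, ENNReal.toReal_ofReal', inv_mul_eq_div]
  congr 1
  rcases le_total s j with h | h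
  · rw [min_eq_left h, min_eq_left (by linarith), max_eq_right (by linarith), sub_self]
  · rw [min_eq_right h, max_eq_left]
    rw [sub_nonneg, le_min_iff]
    exact ⟨h, by linarith⟩

/-- The item selected in a round in which the set `S` and the rank `i` have been drawn. -/
def pick (ρ : Ranking E) (v : E → ℝ) (S : Finset E) (i : ℕ) : Option E :=
  ((ρ.list S fun e => if e ∈ S then v e else 0)[i - 1]?).filter
    fun e => 0 ≤ if e ∈ S then v e else 0

/-- Law of the item selected in a round in which the marginal utilities are given by `v`. -/
def choice (ρ : Ranking E) (m : ℕ) (hm : m ≤ Fintype.card E) (s : ℝ) (v : E → ℝ) :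
    PMF (Option E) :=
  (uniformSubset E m hm).bind fun S => (ceilUniform s).map (pick ρ v S)

/-- Position of the item `e` when the items of `S` are sorted by `v`. -/
def rank (ρ : Ranking E) (v : E → ℝ) (S : Finset E) (e : E) : ℕ :=
  (ρ.list S fun e => if e ∈ S then v e else 0).idxOf e

/-- The part of `(0, s]` that falls into the unit interval `(j, j + 1]`. -/
def slot (s : ℝ) (j : ℕ) : ℝ := min s (j + 1) - min s j

theorem slot_le_one (s : ℝ) (j : ℕ) : slot s j ≤ 1 := by
  have : min s ((j : ℝ) + 1) ≤ min s j + 1 := by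
    rcases le_total s j with h | h
    · rw [min_eq_left h]; exact (min_le_left _ _).trans (by linarith)
    · rw [min_eq_right h]; exact min_le_right _ _
  rw [slot]; linarith

omit [Fintype E] in
theorem pick_eq_some_iff (ρ : Ranking E) (v : E → ℝ) (S : Finset E) (i : ℕ) (e : E) :
    pick ρ v S i = some e ↔ e ∈ S ∧ 0 ≤ v e ∧ i - 1 = rank ρ v S e := by
  have hm := ρ.mem_list S fun e => if e ∈ S then v e else 0
  have hn := ρ.nodup S fun e => if e ∈ S then v e else 0
  rw [pick, rank, Option.filter_eq_some_iff, decide_eq_true_eq]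
  constructor
  · rintro ⟨h1, h2⟩
    have he : e ∈ S := (hm e).1 (List.mem_of_getElem? h1)
    rw [if_pos he] at h2
    refine ⟨he, h2, ?_⟩
    obtain ⟨hlt, h3⟩ := List.getElem?_eq_some_iff.1 h1
    rw [← h3, hn.idxOf_getElem]
  · rintro ⟨he, h2, h3⟩
    rw [if_pos he]
    refine ⟨?_, h2⟩
    rw [h3]
    exact List.getElem?_idxOf ((hm e).2 he)

omit [Fintype E] in
theorem map_pick_apply (ρ : Ranking E) {s : ℝ} (hs : 0 < s) (v : E → ℝ) (S : Finset E) (e : E) :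
    ((ceilUniform s).map (pick ρ v S) (some e)).toReal =
      if e ∈ S ∧ 0 ≤ v e then slot s (rank ρ v S e) / s else 0 := by
  rw [PMF.map_apply]
  split_ifs with h
  · rw [tsum_eq_single (rank ρ v S e + 1), if_pos, ceilUniform_succ hs, slot]
    · exact ((pick_eq_some_iff ρ v S _ e).2 ⟨h.1, h.2, Nat.add_sub_cancel _ _⟩).symm
    · intro i hi
      split_ifs with h1
      · have h2 := ((pick_eq_some_iff ρ v S _ e).1 h1.symm).2.2
        obtain rfl : i = 0 := by omega
        exact ceilUniform_zero hs
      · rfl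
  · rw [ENNReal.tsum_eq_zero.2 fun i => ?_, ENNReal.toReal_zero]
    rw [if_neg fun h1 => h ?_]
    have := (pick_eq_some_iff ρ v S _ e).1 h1.symm
    exact ⟨this.1, this.2.1⟩

theorem choice_apply (ρ : Ranking E) {m : ℕ} (hm : m ≤ Fintype.card E) {s : ℝ} (hs : 0 < s)
    (v : E → ℝ) (e : E) :
    (choice ρ m hm s v (some e)).toReal = ev (uniformSubset E m hm) fun S =>
      if e ∈ S ∧ 0 ≤ v e then slot s (rank ρ v S e) / s else 0 := by
  rw [choice, PMF.bind_apply, tsum_fintype, ENNReal.toReal_sum fun a _ =>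
    ENNReal.mul_ne_top (PMF.apply_ne_top _ _) (PMF.apply_ne_top _ _)]
  simp only [ENNReal.toReal_mul, map_pick_apply ρ hs, ev]

/-- An item is drawn with probability `m / n`, and then has a rank of probability at most
`1 / s`. -/
theorem choice_apply_le (ρ : Ranking E) {m : ℕ} (hm : m ≤ Fintype.card E) {s : ℝ} (hs : 0 < s)
    (v : E → ℝ) (e : E) :
    (choice ρ m hm s v (some e)).toReal ≤ m / Fintype.card E / s := by
  rw [choice_apply ρ hm hs, ← ev_uniformSubset_mem hm e, div_eq_inv_mul, ← ev_const_mul]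
  refine ev_mono fun S _ => ?_
  by_cases he : e ∈ S
  · rw [if_pos he, mul_one]
    split_ifs
    · rw [div_eq_inv_mul]
      exact mul_le_of_le_one_right (inv_nonneg.2 hs.le) (slot_le_one _ _)
    · exact inv_nonneg.2 hs.le
  · rw [if_neg he, if_neg fun h => he h.1, mul_zero]

omit [Fintype E] in
theorem sum_slot_rank (ρ : Ranking E) {s : ℝ} (hs : 0 ≤ s) (v : E → ℝ) (S : Finset E)
    (hS : s ≤ S.card) : ∑ e ∈ S, slot s (rank ρ v S e) = s := by
  have hm := ρ.mem_list S fun e => if e ∈ S then v e else 0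
  have hn := ρ.nodup S fun e => if e ∈ S then v e else 0
  have hl : (ρ.list S fun e => if e ∈ S then v e else 0).length = S.card := by
    rw [← List.toFinset_card_of_nodup hn]
    congr 1
    ext e; rw [List.mem_toFinset, hm]
  have h1 : ∑ e ∈ S, slot s (rank ρ v S e) = ∑ j ∈ Finset.range S.card, slot s j := by
    refine Finset.sum_bij (fun e _ => rank ρ v S e) (fun e he => ?_) (fun e he e' he' h => ?_)
      (fun j hj => ?_) fun _ _ => rfl
    · rw [Finset.mem_range, ← hl]
      exact List.idxOf_lt_length_of_mem ((hm e).2 he)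
    · exact (List.idxOf_inj ((hm e).2 he)).1 h
    · rw [Finset.mem_range, ← hl] at hj
      exact ⟨_, (hm _).1 (List.getElem_mem hj), hn.idxOf_getElem j hj⟩
  have h2 := Finset.sum_range_sub (fun j : ℕ => min s (j : ℝ)) S.card
  simp only [Nat.cast_add, Nat.cast_one, Nat.cast_zero, min_eq_right hs, min_eq_left hS] at h2
  rw [h1]
  simpa [slot] using h2

omit [Fintype E] in
/-- Filling the slots in decreasing order of the values collects at least as much as spreading
the total weight `s` over the items of a set `T`, with a weight `t ≤ 1` for each of them. The
value `y` at the position `⌊s⌋`, where the weights drop from `1` to `0`, separates the items. -/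
theorem sum_slot_mul_ge (ρ : Ranking E) {s : ℝ} (hs : 0 ≤ s) (v : E → ℝ) {S T : Finset E}
    (hS : s ≤ S.card) (hT : T ⊆ S) {t : ℝ} (ht0 : 0 ≤ t) (ht1 : t ≤ 1) (hts : t * T.card ≤ s) :
    t * ∑ e ∈ T, max (v e) 0 ≤ ∑ e ∈ S, slot s (rank ρ v S e) * max (v e) 0 := by
  have hm := ρ.mem_list S fun e => if e ∈ S then v e else 0
  have hsort := ρ.sorted S fun e => if e ∈ S then v e else 0
  have hcmp : ∀ a ∈ S, ∀ b ∈ S, rank ρ v S a ≤ rank ρ v S b → max (v b) 0 ≤ max (v a) 0 := by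
    intro a ha b hb hab
    rcases hab.eq_or_lt with h | h
    · rw [(List.idxOf_inj ((hm a).2 ha)).1 h]
    · have := List.pairwise_iff_getElem.1 hsort _ _
        (List.idxOf_lt_length_of_mem ((hm a).2 ha)) (List.idxOf_lt_length_of_mem ((hm b).2 hb)) h
      rw [List.getElem_idxOf, List.getElem_idxOf, if_pos ha, if_pos hb] at this
      exact max_le_max_right _ this
  obtain ⟨y, hy0, hy⟩ : ∃ y : ℝ, 0 ≤ y ∧ ∀ e ∈ S,
      (⌊s⌋₊ ≤ rank ρ v S e → max (v e) 0 ≤ y) ∧ (rank ρ v S e ≤ ⌊s⌋₊ → y ≤ max (v e) 0) := by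
    by_cases h : ∃ e₀ ∈ S, rank ρ v S e₀ = ⌊s⌋₊
    · obtain ⟨e₀, he₀, h⟩ := h
      exact ⟨max (v e₀) 0, le_max_right _ _, fun e he =>
        ⟨fun h1 => hcmp _ he₀ _ he (h ▸ h1), fun h1 => hcmp _ he _ he₀ (h ▸ h1)⟩⟩
    · refine ⟨0, le_rfl, fun e he => ⟨fun h1 => (h ?_).elim, fun _ => le_max_right _ _⟩⟩
      have hlt : ⌊s⌋₊ < (ρ.list S fun e => if e ∈ S then v e else 0).length :=
        h1.trans_lt (List.idxOf_lt_length_of_mem ((hm e).2 he))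
      exact ⟨_, (hm _).1 (List.getElem_mem hlt), (ρ.nodup S _).idxOf_getElem _ hlt⟩
  have hpt : ∀ e ∈ S, (slot s (rank ρ v S e) - if e ∈ T then t else 0) * y ≤
      (slot s (rank ρ v S e) - if e ∈ T then t else 0) * max (v e) 0 := by
    intro e he
    obtain ⟨h1, h2⟩ := hy e he
    have hx : (if e ∈ T then t else 0) ∈ Set.Icc (0 : ℝ) 1 := by
      split_ifs
      · exact ⟨ht0, ht1⟩
      · simp
    generalize rank ρ v S e = j at *
    rcases lt_trichotomy j ⌊s⌋₊ with hj | hj | hj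
    · have : ((j + 1 : ℕ) : ℝ) ≤ s := (Nat.le_floor_iff hs).1 hj
      push_cast at this
      have h3 : slot s j = 1 := by
        rw [slot, min_eq_right this, min_eq_right (by linarith)]; ring
      rw [h3]
      exact mul_le_mul_of_nonneg_left (h2 hj.le) (by linarith [hx.2])
    · rw [le_antisymm (h1 hj.ge) (h2 hj.le)]
    · have : s < j := (Nat.floor_lt hs).1 hj
      have h3 : slot s j = 0 := by
        rw [slot, min_eq_left this.le, min_eq_left (by linarith), sub_self]
      rw [h3]
      exact mul_le_mul_of_nonpos_left (h1 hj.le) (by linarith [hx.1])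
  have hsum := Finset.sum_le_sum hpt
  have hT' : ∀ w : E → ℝ, ∑ e ∈ S, (if e ∈ T then t else 0) * w e = t * ∑ e ∈ T, w e :=
    fun w => by
      simp only [ite_mul, zero_mul]
      rw [← Finset.sum_filter, Finset.filter_mem_eq_inter, Finset.inter_eq_right.2 hT,
        Finset.mul_sum]
  simp only [sub_mul, Finset.sum_sub_distrib] at hsum
  rw [hT' fun _ => y, hT', ← Finset.sum_mul, sum_slot_rank ρ hs v S hS, Finset.sum_const,
    nsmul_eq_mul] at hsum
  have := mul_le_mul_of_nonneg_right hts hy0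
  linarith

/-- The expected marginal utility of the item selected in a round, compared with the marginal
utilities of any set of `k` items. -/
theorem sum_choice_mul_ge (ρ : Ranking E) {m : ℕ} (hm : m ≤ Fintype.card E) {s : ℝ}
    (hs : 0 < s) (hsm : s ≤ m) (v : E → ℝ) {M : Finset E} {γ : ℝ}
    (hγ : γ * s ≤ ev (uniformSubset E m hm) fun S => min ((S ∩ M).card : ℝ) s) :
    γ * ∑ e ∈ M, max (v e) 0 ≤
      M.card * ∑ e, (choice ρ m hm s v (some e)).toReal * v e := by
  have h1 : ∑ e, (choice ρ m hm s v (some e)).toReal * v e =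
      ev (uniformSubset E m hm) fun S =>
        s⁻¹ * ∑ e ∈ S, slot s (rank ρ v S e) * max (v e) 0 := by
    simp only [choice_apply ρ hm hs, ev, Finset.sum_mul]
    rw [Finset.sum_comm]
    refine Finset.sum_congr rfl fun S _ => ?_
    simp only [mul_assoc, ← Finset.mul_sum]
    congr 1
    rw [Finset.mul_sum, ← Finset.sum_subset (Finset.subset_univ S)]
    · refine Finset.sum_congr rfl fun e he => ?_
      by_cases h0 : 0 ≤ v e
      · rw [if_pos ⟨he, h0⟩, max_eq_left h0]; ring
      · rw [if_neg fun h => h0 h.2, max_eq_right (not_le.1 h0).le]; ring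
    · intro e _ he
      rw [if_neg fun h => he h.1, zero_mul]
  -- The weight per item of `S ∩ M`; the division by zero for `x = 0` is harmless, see `hg`.
  let g : ℕ → ℝ := fun x => min 1 (s / x)
  have hg0 : ∀ x, 0 ≤ g x := fun x => le_min zero_le_one (by positivity)
  have hg : ∀ x : ℕ, g x * x = min (x : ℝ) s := fun x => by
    rcases Nat.eq_zero_or_pos x with rfl | hx
    · simp [hs.le]
    · have hx' : (0 : ℝ) < x := by exact_mod_cast hx
      rw [min_mul_of_nonneg _ _ hx'.le, one_mul, div_mul_cancel₀ _ hx'.ne']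
  have h2 := ev_symm hm M g fun e => max (v e) 0
  simp only [hg] at h2
  have hw : 0 ≤ ∑ e ∈ M, max (v e) 0 := Finset.sum_nonneg fun e _ => le_max_right _ _
  have h3 := mul_le_mul_of_nonneg_left hγ hw
  rw [← h2] at h3
  have h4 : ev (uniformSubset E m hm) (fun S => g (S ∩ M).card * ∑ e ∈ S ∩ M, max (v e) 0) ≤
      ev (uniformSubset E m hm) fun S => ∑ e ∈ S, slot s (rank ρ v S e) * max (v e) 0 :=
    ev_mono fun S hS => sum_slot_mul_ge ρ hs.le v
      (by rwa [card_of_mem_support_uniformSubset hm hS]) Finset.inter_subset_left (hg0 _)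
      (min_le_left _ _) ((hg _).trans_le (min_le_right _ _))
  have h5 := h3.trans (mul_le_mul_of_nonneg_left h4 (Nat.cast_nonneg M.card))
  rw [h1, ev_const_mul, ← mul_assoc, mul_comm _ s⁻¹, mul_assoc, ← div_eq_inv_mul,
    le_div_iff₀ hs]
  linarith

/-! ### Runs of the linear-time policy -/

omit [Fintype E] in
theorem queryAll_run (oracle : E → PartialRealization E O → ℝ) (φ : E → O)
    (ψ : PartialRealization E O) (l : List E) (val : E → ℝ) (next : (E → ℝ) → Algorithm E O) :
    (queryAll ψ l val next).run oracle φ =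
      ((next fun e => if e ∈ l then oracle e ψ else val e).run oracle φ).map
        fun x => (x.1, x.2 + l.length) := by
  induction l generalizing val with
  | nil => simp [queryAll, ← Function.id_def, PMF.map_id]
  | cons e l ih =>
    rw [queryAll, Algorithm.run, ih, PMF.map_comp]
    have h1 : (fun x => if x ∈ l then oracle x ψ else Function.update val e (oracle e ψ) x) =
        fun x => if x ∈ e :: l then oracle x ψ else val x := by
      ext1 x
      by_cases hx : x = e
      · subst hx; simp
      · simp [hx]
    rw [h1]
    rfl

/-- The part of a round that follows the draws: an item may be selected, and its state observed. -/
def afterPick (φ : E → O) (R : PartialRealization E O → PMF (Finset E × ℕ))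
    (ψ : PartialRealization E O) (a : Option E) : PMF (Finset E × ℕ) :=
  a.elim (R ψ) fun e => (R (observe ψ e (φ e))).map fun x => (insert e x.1, x.2)

theorem linearTimeRounds_run_succ (ρ : Ranking E) (m : ℕ) (hm : m ≤ Fintype.card E) (s : ℝ)
    (oracle : E → PartialRealization E O → ℝ) (φ : E → O) (r : ℕ) (ψ : PartialRealization E O) :
    (linearTimeRounds ρ m hm s (r + 1) ψ).run oracle φ =
      (uniformSubset E m hm).bind fun S => (ceilUniform s).bind fun i =>
        (afterPick φ (fun ψ => (linearTimeRounds ρ m hm s r ψ).run oracle φ) ψ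
          (pick ρ (fun e => oracle e ψ) S i)).map fun x => (x.1, x.2 + S.card) := by
  rw [linearTimeRounds, Algorithm.run]
  congr 1; ext1 S
  rw [Algorithm.run]
  congr 1; ext1 i
  rw [queryAll_run, Finset.length_toList]
  simp only [Finset.mem_toList]
  congr 1
  rw [pick]
  cases (ρ.list S fun e => if e ∈ S then oracle e ψ else 0)[i - 1]? with
  | none => rfl
  | some e =>
    by_cases h : 0 ≤ if e ∈ S then oracle e ψ else 0
    · simp only [Option.filter, h, decide_true, if_true, afterPick, Option.elim_some,
        Algorithm.run]
    · simp only [Option.filter, h, decide_false, if_false, afterPick, Option.elim_none,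
        Bool.false_eq_true]

/-- Every run of `r` rounds selects at most `r` items and makes exactly `r m` queries. -/
theorem linearTimeRounds_support (ρ : Ranking E) (m : ℕ) (hm : m ≤ Fintype.card E) (s : ℝ)
    (oracle : E → PartialRealization E O → ℝ) (φ : E → O) (r : ℕ) (ψ : PartialRealization E O) :
    ∀ x ∈ ((linearTimeRounds ρ m hm s r ψ).run oracle φ).support,
      x.1.card ≤ r ∧ x.2 = r * m := by
  induction r generalizing ψ with
  | zero =>
    intro x hx
    rw [linearTimeRounds, Algorithm.run, PMF.mem_support_pure_iff] at hx
    simp [hx]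
  | succ r ih =>
    intro x hx
    rw [linearTimeRounds_run_succ, PMF.mem_support_bind_iff] at hx
    obtain ⟨S, hS, hx⟩ := hx
    rw [PMF.mem_support_bind_iff] at hx
    obtain ⟨i, -, hx⟩ := hx
    rw [PMF.mem_support_map_iff] at hx
    obtain ⟨y, hy, rfl⟩ := hx
    have hSm := card_of_mem_support_uniformSubset hm hS
    suffices y.1.card ≤ r + 1 ∧ y.2 = r * m from
      ⟨this.1, by simp only [this.2, hSm]; ring⟩
    cases h : pick ρ (fun e => oracle e ψ) S i with
    | none =>
      rw [h, afterPick, Option.elim_none] at hy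
      exact ⟨(ih _ _ hy).1.trans (Nat.le_succ r), (ih _ _ hy).2⟩
    | some e =>
      rw [h, afterPick, Option.elim_some, PMF.mem_support_map_iff] at hy
      obtain ⟨z, hz, rfl⟩ := hy
      exact ⟨(Finset.card_insert_le _ _).trans (Nat.succ_le_succ (ih _ _ hz).1), (ih _ _ hz).2⟩

/-- The selected set of the linear-time policy follows a greedy process. -/
theorem linearTimeRounds_map_union (ρ : Ranking E) (m : ℕ) (hm : m ≤ Fintype.card E) (s : ℝ)
    (oracle : E → PartialRealization E O → ℝ) (φ : E → O) (r : ℕ) (A : Finset E) :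
    ((linearTimeRounds ρ m hm s r (restr A φ)).run oracle φ).map (fun x => A ∪ x.1) =
      greedyLaw (fun ψ => choice ρ m hm s fun e => oracle e ψ) φ r A := by
  induction r generalizing A with
  | zero => rw [linearTimeRounds, Algorithm.run, PMF.pure_map, greedyLaw, Finset.union_empty]
  | succ r ih =>
    rw [linearTimeRounds_run_succ, greedyLaw, choice, PMF.map_bind, PMF.bind_bind]
    congr 1; ext1 S
    rw [PMF.map_bind, PMF.bind_map]
    congr 1; ext1 i
    rw [PMF.map_comp, Function.comp_apply]
    cases pick ρ (fun e => oracle e (restr A φ)) S i with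
    | none => exact ih A
    | some e =>
      rw [afterPick, Option.elim_some, observe_restr, PMF.map_comp, addOpt, Option.elim_some,
        ← ih]
      congr 1; ext1 x
      simp

theorem sampleSize_le (n k : ℕ) (ε : ℝ) : sampleSize n k ε ≤ n := min_le_right _ _

theorem linearTimeRun_map_fst (p : PMF (E → O)) (f : Finset E → (E → O) → ℝ) (ρ : Ranking E)
    (k : ℕ) (ε : ℝ) (φ : E → O) :
    (linearTimeRun p f ρ k ε φ).map Prod.fst =
      greedyLaw (fun ψ => choice ρ (sampleSize (Fintype.card E) k ε) (sampleSize_le _ k ε)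
        (sParam (Fintype.card E) k ε) fun e => marginal p f {e} ψ) φ k ∅ := by
  rw [← linearTimeRounds_map_union ρ _ (sampleSize_le _ k ε) _
    (fun e ψ => marginal p f {e} ψ) φ k ∅, restr_empty]
  simp only [Finset.empty_union]
  rfl

/-! ### The parameters -/

section parameters

variable {n k : ℕ} {ε : ℝ}

theorem log_inv_two_mul_pos (hε : 0 < ε) (hε2 : ε < 1 / 2) : 0 < Real.log (2 * ε)⁻¹ :=
  Real.log_pos ((one_lt_inv₀ (by linarith)).2 (by linarith))

theorem mul_qParam (hk : 1 ≤ k) (ε : ℝ) :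
    k * qParam k ε = 8 * (ε ^ 2)⁻¹ * Real.log (2 * ε)⁻¹ := by
  have : (k : ℝ) ≠ 0 := by positivity
  rw [qParam]
  field_simp

theorem qParam_pos (hk : 1 ≤ k) (hε : 0 < ε) (hε2 : ε < 1 / 2) : 0 < qParam k ε := by
  have := log_inv_two_mul_pos hε hε2
  have : (0 : ℝ) < k := by exact_mod_cast hk
  rw [qParam]
  positivity

theorem sampleSize_pos (hn : 1 ≤ n) (hk : 1 ≤ k) (hε : 0 < ε) (hε2 : ε < 1 / 2) :
    1 ≤ sampleSize n k ε := by
  have := qParam_pos hk hε hε2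
  have hn' : (0 : ℝ) < n := by exact_mod_cast hn
  exact le_min (Nat.one_le_ceil_iff.2 (by positivity)) hn

theorem mul_sampleSize_le (hk : 1 ≤ k) (hkn : k ≤ n) (hε : 0 < ε) (hε2 : ε < 1 / 2) :
    (k : ℝ) * sampleSize n k ε ≤ 9 * (n * (ε ^ 2)⁻¹ * Real.log ε⁻¹) := by
  have hq := qParam_pos hk hε hε2
  have h1 : (sampleSize n k ε : ℝ) ≤ qParam k ε * n + 1 := by
    have := (Nat.ceil_lt_add_one (show 0 ≤ qParam k ε * n by positivity)).le
    exact le_trans (by exact_mod_cast min_le_left _ _) this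
  have h2 : (k : ℝ) * sampleSize n k ε ≤ 8 * (ε ^ 2)⁻¹ * Real.log (2 * ε)⁻¹ * n + k := by
    rw [← mul_qParam hk ε]
    nlinarith [show (0 : ℝ) ≤ k from Nat.cast_nonneg k]
  have h3 : Real.log (2 * ε)⁻¹ ≤ Real.log ε⁻¹ := by
    apply Real.log_le_log (by positivity)
    exact inv_anti₀ hε (by linarith)
  have h4 : (1 : ℝ) ≤ (ε ^ 2)⁻¹ * Real.log ε⁻¹ := by
    have h5 : (4 : ℝ) ≤ (ε ^ 2)⁻¹ := by
      rw [le_inv_comm₀ (by norm_num) (by positivity)]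
      nlinarith
    have h6 : Real.log 2 ≤ Real.log ε⁻¹ := by
      apply Real.log_le_log (by norm_num)
      rw [le_inv_comm₀ (by norm_num) hε]
      linarith
    have := Real.log_two_gt_d9
    nlinarith
  have h7 : (k : ℝ) ≤ n := by exact_mod_cast hkn
  have h8 : 8 * (ε ^ 2)⁻¹ * Real.log (2 * ε)⁻¹ * n ≤ 8 * (ε ^ 2)⁻¹ * Real.log ε⁻¹ * n := by
    gcongr
  have h9 : (n : ℝ) ≤ n * ((ε ^ 2)⁻¹ * Real.log ε⁻¹) :=
    le_mul_of_one_le_right (Nat.cast_nonneg n) h4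
  linarith

/-- A random set of the prescribed size contains, up to the fraction `ε`, as many of any `k` items
as expected. If the set is not all of `E`, the expected number is at least `2 / ε ^ 2`. -/
theorem ev_min_card_inter_sParam_ge (hk : 1 ≤ k) (hε : 0 < ε)
    (hε2 : ε < 1 / 2) (hεe : ε < 1 / Real.exp 1) {M : Finset E} (hM : M.card = k) :
    (1 - ε) * sParam (Fintype.card E) k ε ≤
      ev (uniformSubset E (sampleSize (Fintype.card E) k ε) (sampleSize_le _ k ε))
        fun S => min ((S ∩ M).card : ℝ) (sParam (Fintype.card E) k ε) := by
  have hkn : k ≤ Fintype.card E := hM ▸ M.card_le_univ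
  have hn : (0 : ℝ) < Fintype.card E := by exact_mod_cast hk.trans hkn
  have hk0 : (0 : ℝ) < k := by exact_mod_cast hk
  rcases le_total (Fintype.card E) ⌈qParam k ε * Fintype.card E⌉₊ with h | h
  · have hm : sampleSize (Fintype.card E) k ε = Fintype.card E := min_eq_right h
    have hs : sParam (Fintype.card E) k ε = k := by
      rw [sParam, hm, mul_div_cancel_right₀ _ hn.ne']
    rw [hs]
    refine le_trans ?_ (ev_mono (g := fun _ => (k : ℝ)) fun S hS => ?_)
    · rw [ev_const]; nlinarith
    · have hSu : S = Finset.univ := Finset.eq_univ_of_card S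
        ((card_of_mem_support_uniformSubset _ hS).trans hm)
      rw [hSu, Finset.univ_inter, hM, min_self]
  · have hm : sampleSize (Fintype.card E) k ε = ⌈qParam k ε * Fintype.card E⌉₊ := min_eq_left h
    refine ev_min_card_inter_ge _ M (by rw [sParam, hM, mul_div_assoc]) hε ?_
    have h1 : qParam k ε * Fintype.card E ≤ sampleSize (Fintype.card E) k ε := by
      rw [hm]; exact Nat.le_ceil _
    have h2 : k * qParam k ε ≤ sParam (Fintype.card E) k ε := by
      rw [sParam, le_div_iff₀ hn, mul_assoc]
      exact mul_le_mul_of_nonneg_left h1 hk0.le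
    rw [mul_qParam hk] at h2
    have h3 : 1 / 4 ≤ Real.log (2 * ε)⁻¹ := by
      have h4 := Real.one_sub_inv_le_log_of_pos (show 0 < (2 * ε)⁻¹ by positivity)
      rw [inv_inv] at h4
      have h5 : ε < 3 / 8 := hεe.trans_le (by
        rw [div_le_div_iff₀ (Real.exp_pos 1) (by norm_num)]
        linarith [Real.exp_one_gt_d9])
      linarith
    calc (2 : ℝ) ≤ 8 * Real.log (2 * ε)⁻¹ := by linarith
      _ = 8 * (ε ^ 2)⁻¹ * Real.log (2 * ε)⁻¹ * ε ^ 2 := by field_simp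
      _ ≤ _ := mul_le_mul_of_nonneg_right h2 (sq_nonneg ε)

theorem inv_exp_one_le_pow (hk : 1 ≤ k) : 1 / Real.exp 1 ≤ (1 - 1 / (k : ℝ)) ^ (k - 1) := by
  obtain ⟨j, rfl⟩ : ∃ j, k = j + 1 := ⟨k - 1, by omega⟩
  rw [Nat.add_sub_cancel]
  rcases Nat.eq_zero_or_pos j with rfl | hj
  · rw [pow_zero, div_le_one (Real.exp_pos 1)]
    exact Real.one_le_exp zero_le_one
  · have hj' : (0 : ℝ) < j := by exact_mod_cast hj
    have h1 : (1 : ℝ) - 1 / ((j + 1 : ℕ) : ℝ) = (1 / (j : ℝ) + 1)⁻¹ := by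
      push_cast
      field_simp
      ring
    have h2 : (1 / (j : ℝ) + 1) ^ j ≤ Real.exp 1 := by
      calc (1 / (j : ℝ) + 1) ^ j ≤ Real.exp (1 / j) ^ j :=
            pow_le_pow_left₀ (by positivity) (Real.add_one_le_exp _) j
        _ = Real.exp 1 := by
            rw [← Real.exp_nat_mul]; congr 1; field_simp
    rw [h1, inv_pow, one_div]
    exact inv_anti₀ (by positivity) h2

end parameters

/-! ### The approximation guarantee -/

theorem expectedUtility_nonneg {p : PMF (E → O)} {f : Finset E → (E → O) → ℝ}
    (hf0 : ∀ S φ, 0 ≤ f S φ) (sel : (E → O) → PMF (Finset E)) : 0 ≤ expectedUtility p f sel :=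
  tsum_nonneg fun φ => mul_nonneg ENNReal.toReal_nonneg (ev_nonneg fun S => hf0 S φ)

theorem linearTimePolicy_approximation {p : PMF (E → O)} {f : Finset E → (E → O) → ℝ}
    (hf0 : ∀ S φ, 0 ≤ f S φ) (hf : ∀ S, Integ p (f S)) (hs : AdaptiveSubmodular p f)
    (ρ : Ranking E) {k : ℕ} (hk : 1 ≤ k) (hkn : k ≤ Fintype.card E) {ε : ℝ} (hε : 0 < ε)
    (hε2 : ε < 1 / 2) (hεe : ε < 1 / Real.exp 1) {π : Policy E O} (hπ : π.Feasible k) :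
    (1 / Real.exp 1 - ε) * expectedUtility p f π.selected ≤
      expectedUtility p f fun φ => (linearTimeRun p f ρ k ε φ).map Prod.fst := by
  have hk0 : (0 : ℝ) < k := by exact_mod_cast hk
  have hk1 : (1 : ℝ) ≤ k := by exact_mod_cast hk
  have hn0 : (0 : ℝ) < Fintype.card E := by exact_mod_cast hk.trans hkn
  have hm0 : (0 : ℝ) < sampleSize (Fintype.card E) k ε := by
    exact_mod_cast sampleSize_pos (hk.trans hkn) hk hε hε2
  have hs0 : 0 < sParam (Fintype.card E) k ε := by rw [sParam]; positivity
  have hsm : sParam (Fintype.card E) k ε ≤ sampleSize (Fintype.card E) k ε := by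
    rw [sParam, div_le_iff₀ hn0, mul_comm]
    exact mul_le_mul_of_nonneg_left (by exact_mod_cast hkn) hm0.le
  have hmean := mean_greedyLaw_ge (k := k) (q := 1 / k) (θ := (1 - ε) / k)
    (κ := fun ψ => choice ρ (sampleSize (Fintype.card E) k ε) (sampleSize_le _ k ε)
      (sParam (Fintype.card E) k ε) fun e => marginal p f {e} ψ) hf0 hf hs (by positivity)
    (by rw [div_le_one hk0]; exact hk1) (fun ψ e => ?_)
    (div_nonneg (by linarith) hk0.le) (div_le_div_of_nonneg_right (by linarith) hk0.le)
    (fun ψ S hS => ?_) hπ k ∅ weight_one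
  · simp only [one_mul, Finset.empty_union] at hmean
    have e1 : ∀ sel : (E → O) → PMF (Finset E),
        expectedUtility p f sel = mean p fun φ => ev (sel φ) fun S => f S φ := fun _ => rfl
    simp only [linearTimeRun_map_fst]
    rw [← e1, ← e1, mul_div_cancel₀ _ hk0.ne'] at hmean
    refine le_trans ?_ hmean
    have h1 := inv_exp_one_le_pow hk
    have h2 : 0 ≤ 1 / Real.exp 1 := by positivity
    have h3 : 1 / Real.exp 1 ≤ 1 := by
      rw [div_le_one (Real.exp_pos 1)]; exact Real.one_le_exp zero_le_one
    have h4 : 1 / Real.exp 1 - ε ≤ (1 - ε) * (1 - 1 / (k : ℝ)) ^ (k - 1) := by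
      nlinarith
    have h5 := mul_le_mul_of_nonneg_right h4 (expectedUtility_nonneg (p := p) hf0 π.selected)
    have h6 : 0 ≤ (1 - 1 / (k : ℝ)) ^ k * mean p fun φ => f ∅ φ := by
      refine mul_nonneg (pow_nonneg ?_ k) (mean_nonneg fun φ => hf0 _ _)
      rw [sub_nonneg, div_le_one hk0]; exact hk1
    linarith
  · refine (choice_apply_le ρ _ hs0 _ e).trans (le_of_eq ?_)
    rw [sParam]
    field_simp
  · obtain ⟨M, hSM, hM⟩ := Finset.exists_superset_card_eq hS hkn
    have h := sum_choice_mul_ge ρ (sampleSize_le _ k ε) hs0 hsm (fun e => marginal p f {e} ψ)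
      (ev_min_card_inter_sParam_ge hk hε hε2 hεe hM)
    rw [hM] at h
    rw [div_mul_eq_mul_div, div_le_iff₀' hk0]
    refine le_trans (mul_le_mul_of_nonneg_left ?_ (by linarith)) h
    exact Finset.sum_le_sum_of_subset_of_nonneg hSM fun _ _ _ => le_max_right _ _

end AdaptiveSubmod

end

theorem mainTheorem2 :
    ∃ C : ℝ, ∀ (E : Type*) (O : Type*) [Fintype E]
      (p : PMF (E → O)) (f : Finset E → (E → O) → ℝ)
      (_hf_nonneg : ∀ S φ, 0 ≤ f S φ)
      (_hf_integrable : ∀ S, Summable fun φ => (p φ).toReal * f S φ)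
      (_hf_submod : AdaptiveSubmod.AdaptiveSubmodular p f)
      (ρ : AdaptiveSubmod.Ranking E)
      (k : ℕ) (_hk : 1 ≤ k) (_hkn : k ≤ Fintype.card E)
      (ε : ℝ) (_hε_pos : 0 < ε) (_hε_lt : ε < 1 / 2),
      (∀ φ, ∀ x ∈ (AdaptiveSubmod.linearTimeRun p f ρ k ε φ).support, x.1.card ≤ k) ∧
      (∀ π : AdaptiveSubmod.Policy E O, π.Feasible k →
        (1 / Real.exp 1 - ε) * AdaptiveSubmod.expectedUtility p f π.selected ≤
          AdaptiveSubmod.expectedUtility p f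
            fun φ => (AdaptiveSubmod.linearTimeRun p f ρ k ε φ).map Prod.fst) ∧
      (∀ φ, ∀ x ∈ (AdaptiveSubmod.linearTimeRun p f ρ k ε φ).support,
        (x.2 : ℝ) ≤ C * (Fintype.card E * (ε ^ 2)⁻¹ * Real.log ε⁻¹)) := by
  refine ⟨9, fun E O _ p f hf0 hf hs ρ k hk hkn ε hε hε2 => ⟨fun φ x hx => ?_, fun π hπ => ?_,
    fun φ x hx => ?_⟩⟩
  · exact (AdaptiveSubmod.linearTimeRounds_support ρ _ _ _ _ φ k _ x hx).1
  · rcases lt_or_ge ε (1 / Real.exp 1) with hεe | hεe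
    · exact AdaptiveSubmod.linearTimePolicy_approximation hf0 hf hs ρ hk hkn hε hε2 hεe hπ
    · -- The claimed factor is not positive, and utilities are nonnegative.
      exact (mul_nonpos_of_nonpos_of_nonneg (by linarith)
        (AdaptiveSubmod.expectedUtility_nonneg hf0 _)).trans
        (AdaptiveSubmod.expectedUtility_nonneg hf0 _)
  · rw [(AdaptiveSubmod.linearTimeRounds_support ρ _ _ _ _ φ k _ x hx).2]
    push_cast
    exact AdaptiveSubmod.mul_sampleSize_le hk hkn hε hε2
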